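/- Let $G=(V,E)$ be a finite connected graph without loops (multiple edges allowed), and let $\ell:E\to\mathbb Z_{>0}$ be an edge length function. Let $\mathbb E$ be the set of oriented edges of $G$; we write $e=uv$ for an oriented edge with tail $u$ and head $v$, $\overline e$ for its reverse, and $\ell_e=\ell_{\overline e}$ for the length of the underlying edge. Let $C^0(G,A)$ be the set of functions $V\to A$ (for $A=\mathbb Z,\mathbb R$), let $C^1(G,\mathbb R)$ be the space of functions $\alpha:\mathbb E\to\mathbb R$ with $\alpha(\overline e)=-\alpha(e)$, let $d:C^0(G,\mathbb R)\to C^1(G,\mathbb R)$, $d(f)(uv)=f(v)-f(u)$, and let $d^*:C^1(G,\mathbb R)\to C^0(G,\mathbb R)$, $d^*(\alpha)(v)=\sum_{e\text{ with head }v}\alpha(e)$, be its adjoint. Put $\Delta=d^*d$ and $H_{0,\mathbb R}=\{f\in C^0(G,\mathbb R): \sum_{v\in V} f(v)=0\}$. For a connected spanning subgraph $G'$ of $G$, with its own operators $d_{G'}, d^*_{G'}, \Delta_{G'}$ on $C^0(G',\mathbb R)=C^0(G,\mathbb R)$, let $\Lambda_{G'}=\Delta_{G'}(C^0(G,\mathbb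 Z))$, let $q_{G'}(h)=\sum_{v}g(v)h(v)$ for $h\in H_{0,\mathbb R}$ and any $g$ with $\Delta_{G'}(g)=h$, and let $$\mathrm{Vor}_{G'}(O)=\{\eta\in H_{0,\mathbb R} : q_{G'}(\eta)\le q_{G'}(\eta-\alpha)\text{ for all }\alpha\in\Lambda_{G'}\}.$$ For $f\in C^0(G,\mathbb Z)$ and $e=uv\in\mathbb E$ put $\delta_e(f)=\lfloor (f(v)-f(u))/\ell_e\rfloor$, and let $\mathfrak d_f\in C^1(G,\mathbb R)$ be given by $\mathfrak d_f(e)=\frac12(\delta_e(f)-\delta_{\overline e}(f))$. Let $G_f$ be the spanning subgraph of $G$ whose edges are those with ends $u,v$ such that $\ell_e$ divides $f(v)-f(u)$. Let $$\square_f=\{\mathfrak d_f+\epsilon : \epsilon\in C^1(G,\mathbb R),\ |\epsilon(e)|\le\tfrac12\text{ for all }e,\ \epsilon(e)=0\text{ for all }e\text{ not in }G_f\},\qquad \mathrm{Vor}_H(f)=d^*(\square_f).$$ A tiling of a real vector space $W$ by polytopes is a family of polytopes in $W$ covering $W$ such that each (non-empty) face of a member is a member, and any two members are either disjoint or meet in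 a common face of both. Then the set of all faces of the $\mathrm{Vor}_H(f)$, for $f\in C^0(G,\mathbb Z)$ with $G_f$ connected (each polytope being a face of itself), is a tiling of $H_{0,\mathbb R}$ by polytopes, and the members of this tiling of full dimension $\dim H_{0,\mathbb R}$ are exactly the $\mathrm{Vor}_H(f)$ with $G_f$ connected. Each full-dimensional member is congruent, in fact a translate, of the Voronoi cell $\mathrm{Vor}_{G'}(O)$ of a connected spanning subgraph $G'$ of $G$. More precisely, for each $f\in C^0(G,\mathbb Z)$ with $G_f$ connected, $$\mathrm{Vor}_H(f)=d^*(\mathfrak d_f)+\mathrm{Vor}_{G_f}(O).$$ -/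

import Mathlib

open scoped Graph

noncomputable section

namespace MixedVoronoi

/-! ### Tilings by polytopes -/

section Tiling

variable {X : Type*} [AddCommGroup X] [Module ℝ X]

/-- A (convex) polytope: the convex hull of a non-empty finite set. -/
def IsPolytope (P : Set X) : Prop :=
  ∃ s : Set X, s.Finite ∧ s.Nonempty ∧ P = convexHull ℝ s

/-- `F` is a (non-empty) face of `P`: the set of points of `P` at which some linear functional
attains its maximum over `P`. The zero functional gives `P` itself. -/
def IsFace [TopologicalSpace X] (P F : Set X) : Prop :=
  F.Nonempty ∧ IsExposed ℝ P F

/-- The dimension of a convex set: the dimension of its affine span. -/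
def dim (P : Set X) : ℕ := Module.finrank ℝ (vectorSpan ℝ P)

/-- A tiling of the vector space `W` by polytopes: a family of polytopes whose union is `W`, which
contains each face of each of its members, and such that any two members are disjoint or meet in
a common face. -/
structure IsTiling [TopologicalSpace X] (W : Submodule ℝ X) (T : Set (Set X)) : Prop where
  isPolytope : ∀ P ∈ T, IsPolytope P
  sUnion_eq : ⋃₀ T = (W : Set X)
  face_mem : ∀ P ∈ T, ∀ F, IsFace P F → F ∈ T
  inter : ∀ P ∈ T, ∀ Q ∈ T, P ∩ Q = ∅ ∨ (IsFace P (P ∩ Q) ∧ IsFace Q (P ∩ Q))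

end Tiling

/-! ### Graphs and their cochain complexes

`G : Graph V E` is a multigraph. All definitions below are used for graphs whose vertex set is the
whole finite type `V`, so that `V → ℝ` is the space of `0`-cochains of `G` and of all of its
spanning subgraphs. -/

variable {V E : Type*}

/-- A graph is connected if it has a vertex and any two of its vertices are joined by a path. -/
def IsConnected (G : Graph V E) : Prop :=
  V(G).Nonempty ∧ ∀ u ∈ V(G), ∀ v ∈ V(G), Relation.ReflTransGen G.Adj u v

/-- The oriented edges of `G`: an edge together with an ordering (tail, head) of its two ends. -/
structure OrientedEdge (G : Graph V E) where
  edge : E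
  tail : V
  head : V
  isLink : G.IsLink edge tail head

namespace OrientedEdge

variable {G : Graph V E}

/-- The same edge with the reverse orientation. -/
def rev (e : OrientedEdge G) : OrientedEdge G := ⟨e.edge, e.head, e.tail, e.isLink.symm⟩

@[simp] theorem rev_edge (e : OrientedEdge G) : e.rev.edge = e.edge := rfl
@[simp] theorem rev_tail (e : OrientedEdge G) : e.rev.tail = e.head := rfl
@[simp] theorem rev_head (e : OrientedEdge G) : e.rev.head = e.tail := rfl
@[simp] theorem rev_rev (e : OrientedEdge G) : e.rev.rev = e := rfl

instance [Finite V] [Finite E] : Finite (OrientedEdge G) :=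
  Finite.of_injective (fun e : OrientedEdge G => (e.edge, e.tail, e.head)) (by
    rintro ⟨a, b, c, h⟩ ⟨a', b', c', h'⟩ hh
    simp only [Prod.mk.injEq] at hh
    obtain ⟨rfl, rfl, rfl⟩ := hh
    rfl)

instance [Finite V] [Finite E] : Fintype (OrientedEdge G) := Fintype.ofFinite _

end OrientedEdge

/-- The real `1`-cochains: functions on oriented edges that change sign under reversal. -/
def C1 (G : Graph V E) : Submodule ℝ (OrientedEdge G → ℝ) where
  carrier := {α | ∀ e, α e.rev = -α e}
  add_mem' := by
    intro a b ha hb e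
    simp only [Set.mem_ofPred_eq] at ha hb
    simp only [Pi.add_apply, ha e, hb e]
    ring
  zero_mem' := by intro e; simp
  smul_mem' := by
    intro c a ha e
    simp only [Set.mem_ofPred_eq] at ha
    simp only [Pi.smul_apply, ha e, smul_eq_mul]
    ring

/-- The differential: `(d f) e = f v - f u` for an oriented edge `e` from `u` to `v`. -/
def d (G : Graph V E) : (V → ℝ) →ₗ[ℝ] C1 G where
  toFun f := ⟨fun e => f e.head - f e.tail, fun e => by simp⟩
  map_add' f g := by
    ext e
    simp only [Submodule.coe_add, Pi.add_apply]
    ring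
  map_smul' c f := by
    ext e
    simp only [Submodule.coe_smul, Pi.smul_apply, smul_eq_mul, RingHom.id_apply]
    ring

open Classical in
/-- The adjoint `d^*` of `d` (the boundary map): the value of `d^* α` at `v` is the sum of the
values of `α` on the oriented edges with head `v`. -/
def dStar [Finite V] [Finite E] (G : Graph V E) : C1 G →ₗ[ℝ] (V → ℝ) where
  toFun α := fun v => ∑ e with OrientedEdge.head e = v, (α : OrientedEdge G → ℝ) e
  map_add' α β := by
    ext v
    simp [Finset.sum_add_distrib]
  map_smul' c α := by
    ext v
    simp [Finset.mul_sum]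

/-- `d^*` is adjoint to `d` for the standard scalar products. On `1`-cochains each edge counts
once, whence the factor `1/2` in the sum over oriented edges. -/
theorem dStar_adjoint [Fintype V] [Finite E] (G : Graph V E) (f : V → ℝ) (α : C1 G) :
    ∑ v, f v * dStar G α v =
      (1 / 2) * ∑ e, (d G f : OrientedEdge G → ℝ) e * (α : OrientedEdge G → ℝ) e := by
  classical
  have h1 : ∑ v, f v * dStar G α v =
      ∑ e : OrientedEdge G, f e.head * (α : OrientedEdge G → ℝ) e := by
    rw [← Finset.sum_fiberwise (s := Finset.univ) (g := fun e : OrientedEdge G => e.head)]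
    refine Finset.sum_congr rfl fun v _ => ?_
    simp only [dStar, LinearMap.coe_mk, AddHom.coe_mk, Finset.mul_sum]
    refine Finset.sum_congr (by congr) fun e he => ?_
    rw [(Finset.mem_filter.mp he).2]
  have h2 : ∑ e : OrientedEdge G, f e.tail * (α : OrientedEdge G → ℝ) e =
      -∑ e : OrientedEdge G, f e.head * (α : OrientedEdge G → ℝ) e := by
    rw [← Finset.sum_neg_distrib]
    refine Fintype.sum_equiv
      ⟨OrientedEdge.rev, OrientedEdge.rev, OrientedEdge.rev_rev, OrientedEdge.rev_rev⟩ _ _ ?_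
    intro e
    have := α.2 e
    simp only [Equiv.coe_fn_mk, OrientedEdge.rev_head, this]
    ring
  rw [h1]
  simp only [d, LinearMap.coe_mk, AddHom.coe_mk, sub_mul, Finset.sum_sub_distrib, h2]
  ring

/-- The Laplacian `Δ = d^* d`. -/
def laplacian [Finite V] [Finite E] (G : Graph V E) : (V → ℝ) →ₗ[ℝ] (V → ℝ) :=
  dStar G ∘ₗ d G

variable (V) in
/-- The hyperplane `H_{0,ℝ}` of real functions on the vertices with sum zero. -/
def H0 [Fintype V] : Submodule ℝ (V → ℝ) where
  carrier := {f | ∑ v, f v = 0}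
  add_mem' := by
    intro a b ha hb
    simp only [Set.mem_ofPred_eq] at ha hb
    simp [Finset.sum_add_distrib, ha, hb]
  zero_mem' := by simp
  smul_mem' := by
    intro c a ha
    simp only [Set.mem_ofPred_eq] at ha
    simp [← Finset.mul_sum, ha]

/-! ### The Voronoi cells of the Laplacian lattice -/

/-- The Laplacian lattice `Λ_ℤ`: the image under `d^*` of the lattice of integer cuts, which
consists of the `d f` with `f` an integer function on the vertices. -/
def laplacianLattice [Finite V] [Finite E] (G : Graph V E) : Set (V → ℝ) :=
  Set.range fun f : V → ℤ => dStar G (d G fun v => (f v : ℝ))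

open Classical in
/-- The quadratic form `q h = ⟨f, Δ f⟩` for any `f` with `Δ f = h`. For a connected graph each
`h` in `H_{0,ℝ}` is of this form. -/
def q [Fintype V] [Finite E] (G : Graph V E) (h : V → ℝ) : ℝ :=
  if hf : ∃ f, laplacian G f = h then ∑ v, hf.choose v * laplacian G hf.choose v else 0

/-- The value of `q` does not depend on the choice of `f`. -/
theorem q_laplacian [Fintype V] [Finite E] (G : Graph V E) (f : V → ℝ) :
    q G (laplacian G f) = ∑ v, f v * laplacian G f v := by
  have hex : ∃ g, laplacian G g = laplacian G f := ⟨f, rfl⟩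
  have hsymm : ∀ a b : V → ℝ,
      ∑ v, a v * laplacian G b v = ∑ v, b v * laplacian G a v := by
    intro a b
    simp only [laplacian, LinearMap.comp_apply, dStar_adjoint]
    congr 1
    exact Finset.sum_congr rfl fun e _ => mul_comm _ _
  unfold q
  rw [dif_pos hex]
  have hg := hex.choose_spec
  rw [hg, hsymm, hg]

/-- The cell `Vor_G(β)` of the Voronoi decomposition of `H_{0,ℝ}` with respect to the Laplacian
lattice of `G` and the quadratic form `q`. -/
def Vor [Fintype V] [Finite E] (G : Graph V E) (β : V → ℝ) : Set (V → ℝ) :=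
  {η | η ∈ H0 V ∧ ∀ α ∈ laplacianLattice G, q G (η - β) ≤ q G (η - α)}

/-! ### The mixed Voronoi tiling of a graph with edge lengths -/

/-- `δ_e(f) = ⌊(f v - f u) / ℓ_e⌋` for an oriented edge `e` from `u` to `v`. -/
def delta {G : Graph V E} (ℓ : E → ℕ) (f : V → ℤ) (e : OrientedEdge G) : ℤ :=
  ⌊((f e.head : ℝ) - f e.tail) / ℓ e.edge⌋

/-- The point `𝔡_f`, with `𝔡_f(e) = (δ_e(f) - δ_{ē}(f)) / 2`. -/
def frakD (G : Graph V E) (ℓ : E → ℕ) (f : V → ℤ) : C1 G :=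
  ⟨fun e => ((delta ℓ f e : ℝ) - delta ℓ f e.rev) / 2, fun e => by
    simp only [OrientedEdge.rev_rev]
    ring⟩

/-- The spanning subgraph `G_f` of `G`, whose edges are those for which the difference of the
values of `f` at the two ends is divisible by the length of the edge. -/
def subgraph (G : Graph V E) (ℓ : E → ℕ) (f : V → ℤ) : Graph V E :=
  G.restrict {e | ∀ u v, G.IsLink e u v → (ℓ e : ℤ) ∣ f v - f u}

/-- The cube `□_f`, of all `𝔡_f + ε` where all values of `ε` are at most `1/2` in absolute value,
and zero on the oriented edges that are not in `G_f`. -/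
def cube (G : Graph V E) (ℓ : E → ℕ) (f : V → ℤ) : Set (C1 G) :=
  {x | ∃ ε : C1 G, x = frakD G ℓ f + ε ∧
    (∀ e, |(ε : OrientedEdge G → ℝ) e| ≤ 1 / 2) ∧
    ∀ e : OrientedEdge G, e.edge ∉ E(subgraph G ℓ f) → (ε : OrientedEdge G → ℝ) e = 0}

/-- The polytope `Vor_H(f) = d^*(□_f)`. -/
def VorH [Finite V] [Finite E] (G : Graph V E) (ℓ : E → ℕ) (f : V → ℤ) : Set (V → ℝ) :=
  dStar G '' cube G ℓ f

/-- The mixed Voronoi tiling: all (non-empty) faces of the polytopes `Vor_H(f)`, including these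
polytopes themselves, for all integer functions `f` for which `G_f` is connected. -/
def mixedVoronoiTiling [Finite V] [Finite E] (G : Graph V E) (ℓ : E → ℕ) :
    Set (Set (V → ℝ)) :=
  {P | ∃ f : V → ℤ, IsConnected (subgraph G ℓ f) ∧ IsFace (VorH G ℓ f) P}

end MixedVoronoi

end

namespace MixedVoronoi

variable {V E : Type*}


/-! ### Sums over oriented edges -/

/-! The floor defining `bound` makes sense for real vertex functions `f`, and all of the geometry
takes place in the larger family of polytopes `cell G (bound ℓ f)`. For integer `f` such a cell is
`VorH G ℓ f` (`VorH_eq_cell`), since `⌊x⌋ + ⌊-x⌋` is `0` or `-1` according as `x` is an integer or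
not.

On each edge the interval of allowed values is monotone in the slope `f v - f u`: a smaller slope
forces values that are no larger. Summing over edges, `f ↦ cell` behaves like a monotone operator:
`(f₂ - f₁) ⬝ᵥ (x₂ - x₁) ≥ 0`. The equality case shows that two cells that meet do so in the face of
each cut out by `f₂ - f₁` (`cell_bound_inter`). Conversely, the face of the cell of `f` in direction
`g` is the cell of `f + ε • g` for small `ε > 0`. So faces of cells are cells, which gives all
tiling axioms except covering.

For covering, `mem_cell_of_cut_le` reduces membership to one inequality per vertex set `S`. Given `η
= Δ g`, a coercive convex energy on integer functions has a minimizer `f`; comparing `f` with `f +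
1_S` yields the inequality for `S`. If `G_f` is disconnected, raising `f` on a component enlarges
the box until `G_f` is connected.

The same criterion identifies the Voronoi cell at the origin with the image of the cube of
half-width `1/2` (`Vor_zero_eq_cell`): the indicator functions give the cut inequalities, and these
imply all the others. That image absorbs every direction of `H_{0,ℝ}`, whence full dimension; a
proper face has smaller dimension. -/

theorem OrientedEdge.sum_rev [Finite V] [Finite E] {G : Graph V E} (F : OrientedEdge G → ℝ) :
    ∑ e : OrientedEdge G, F e.rev = ∑ e, F e :=
  Fintype.sum_equiv
    ⟨OrientedEdge.rev, OrientedEdge.rev, OrientedEdge.rev_rev, OrientedEdge.rev_rev⟩ _ _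
    fun _ => rfl

theorem C1.apply_rev {G : Graph V E} (α : C1 G) (e : OrientedEdge G) :
    (α : OrientedEdge G → ℝ) e.rev = -(α : OrientedEdge G → ℝ) e := α.2 e

theorem dotProduct_dStar [Fintype V] [Finite E] (G : Graph V E) (f : V → ℝ) (α : C1 G) :
    f ⬝ᵥ dStar G α =
      (1 / 2) * ∑ e : OrientedEdge G, (f e.head - f e.tail) * (α : OrientedEdge G → ℝ) e :=
  dStar_adjoint G f α

theorem dotProduct_laplacian [Fintype V] [Finite E] (G : Graph V E) (f g : V → ℝ) :
    f ⬝ᵥ laplacian G g =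
      (1 / 2) * ∑ e : OrientedEdge G, (f e.head - f e.tail) * (g e.head - g e.tail) :=
  dotProduct_dStar G f (d G g)

theorem dotProduct_laplacian_comm [Fintype V] [Finite E] (G : Graph V E) (f g : V → ℝ) :
    f ⬝ᵥ laplacian G g = g ⬝ᵥ laplacian G f := by
  simp only [dotProduct_laplacian, mul_comm]

theorem mem_H0_iff [Fintype V] {η : V → ℝ} : η ∈ H0 V ↔ ∑ v, η v = 0 := Iff.rfl

theorem dStar_mem_H0 [Fintype V] [Finite E] (G : Graph V E) (α : C1 G) :
    dStar G α ∈ H0 V := by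
  have h := dotProduct_dStar G (fun _ => 1) α
  rw [mem_H0_iff]
  simpa [dotProduct] using h

/-! ### Images of boxes under the boundary map -/

/-- The box of all `1`-cochains bounded above by `a`; by antisymmetry its elements `α` satisfy
`-a ē ≤ α e ≤ a e`. -/
def upperBox (G : Graph V E) (a : OrientedEdge G → ℝ) : Set (C1 G) :=
  {α | ∀ e, (α : OrientedEdge G → ℝ) e ≤ a e}

/-- The image of the box under the boundary map. -/
def cell [Finite V] [Finite E] (G : Graph V E) (a : OrientedEdge G → ℝ) : Set (V → ℝ) :=
  dStar G '' upperBox G a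

theorem cell_mono [Finite V] [Finite E] {G : Graph V E} {a b : OrientedEdge G → ℝ}
    (h : ∀ e, a e ≤ b e) : cell G a ⊆ cell G b :=
  Set.image_mono fun _ hα e => (hα e).trans (h e)

/-- The antisymmetrization of a function on oriented edges. -/
noncomputable def antisymm (G : Graph V E) : (OrientedEdge G → ℝ) →ₗ[ℝ] C1 G where
  toFun β := ⟨fun e => (β e - β e.rev) / 2, fun e => by
    simp only [OrientedEdge.rev_rev]
    ring⟩
  map_add' a b := by
    ext e
    simp only [Submodule.coe_add, Pi.add_apply]
    ring
  map_smul' c a := by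
    ext e
    simp only [Submodule.coe_smul, Pi.smul_apply, smul_eq_mul, RingHom.id_apply]
    ring

theorem antisymm_apply {G : Graph V E} (β : OrientedEdge G → ℝ) (e : OrientedEdge G) :
    (antisymm G β : OrientedEdge G → ℝ) e = (β e - β e.rev) / 2 := rfl

/-- Presents the box as a linear image of a product of intervals, whose corners are explicit; this
makes cells polytopes. -/
theorem upperBox_eq_image (G : Graph V E) (a : OrientedEdge G → ℝ) :
    upperBox G a = antisymm G '' Set.univ.pi fun e => Set.Icc (-a e.rev) (a e) := by
  ext α
  constructor
  · intro hα
    refine ⟨α, fun e _ => ⟨?_, hα e⟩, ?_⟩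
    · have := hα e.rev
      rw [C1.apply_rev] at this
      linarith
    · ext e
      rw [antisymm_apply, C1.apply_rev]
      ring
  · rintro ⟨β, hβ, rfl⟩ e
    have h1 := (hβ e trivial).2
    have h2 := (hβ e.rev trivial).1
    simp only [OrientedEdge.rev_rev] at h2
    rw [antisymm_apply]
    linarith

theorem upperBox_nonempty {G : Graph V E} {a : OrientedEdge G → ℝ}
    (ha : ∀ e, 0 ≤ a e + a e.rev) : (upperBox G a).Nonempty := by
  rw [upperBox_eq_image]
  exact ⟨_, a, fun e _ => ⟨by linarith [ha e], le_rfl⟩, rfl⟩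

theorem cell_nonempty [Finite V] [Finite E] {G : Graph V E} {a : OrientedEdge G → ℝ}
    (ha : ∀ e, 0 ≤ a e + a e.rev) : (cell G a).Nonempty :=
  (upperBox_nonempty ha).image _

theorem isPolytope_cell [Finite V] [Finite E] {G : Graph V E} {a : OrientedEdge G → ℝ}
    (ha : ∀ e, 0 ≤ a e + a e.rev) : IsPolytope (cell G a) := by
  refine ⟨(dStar G ∘ₗ antisymm G) '' Set.univ.pi fun e => {-a e.rev, a e}, ?_, ?_, ?_⟩
  · exact (Set.Finite.pi fun e => Set.toFinite _).image _
  · exact Set.Nonempty.image _ ⟨a, fun e _ => by simp⟩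
  · have h : (Set.univ.pi fun e : OrientedEdge G => Set.Icc (-a e.rev) (a e)) =
        convexHull ℝ (Set.univ.pi fun e => {-a e.rev, a e}) := by
      rw [convexHull_pi]
      congr 1
      ext1 e
      rw [convexHull_pair, segment_eq_Icc]
      linarith [ha e]
    rw [← LinearMap.image_convexHull, ← h, cell, upperBox_eq_image, Set.image_image]
    rfl

theorem IsPolytope.convex {P : Set (V → ℝ)} (h : IsPolytope P) : Convex ℝ P := by
  obtain ⟨s, -, -, rfl⟩ := h
  exact convex_convexHull ℝ s

theorem IsPolytope.isCompact {P : Set (V → ℝ)} (h : IsPolytope P) : IsCompact P := by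
  obtain ⟨s, hs, -, rfl⟩ := h
  exact hs.isCompact_convexHull ℝ

theorem exists_dotProduct_eq [Fintype V] (l : (V → ℝ) →ₗ[ℝ] ℝ) :
    ∃ g : V → ℝ, ∀ x, l x = g ⬝ᵥ x := by
  classical
  refine ⟨fun v => l (Pi.single v 1), fun x => ?_⟩
  conv_lhs => rw [pi_eq_sum_univ' x]
  simp [dotProduct, map_sum, mul_comm]

/-! ### The cut criterion for membership in a cell -/

open Classical in
/-- Inequalities for indicator functions imply the inequality for all functions on the vertices,
which are positive combinations of the indicator functions of their superlevel sets and of a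
constant. -/
theorem dotProduct_le_of_cut_le [Fintype V] [Finite E] {G : Graph V E}
    {a : OrientedEdge G → ℝ} {η : V → ℝ} (hη : η ∈ H0 V)
    (hS : ∀ S : Set V, ∑ v with v ∈ S, η v ≤
      ∑ e : OrientedEdge G with e.head ∈ S ∧ e.tail ∉ S, a e) (g : V → ℝ) :
    g ⬝ᵥ η ≤ ∑ e : OrientedEdge G, max (g e.head - g e.tail) 0 * a e := by
  -- Induction on the number of values of `g`: lowering the top level set `S` to the second largest
  -- value `g w'` removes one value and changes both sides by `g w - g w'` times the cut inequality
  -- for `S`.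
  induction hn : (Finset.univ.image g).card using Nat.strong_induction_on generalizing g with
  | _ n ih =>
  subst hn
  rcases isEmpty_or_nonempty V with hV | hV
  · have : IsEmpty (OrientedEdge G) := ⟨fun e => hV.elim e.head⟩
    simp [dotProduct]
  obtain ⟨w, hw⟩ := Finite.exists_max g
  by_cases hc : ∀ v, g v = g w
  · have h1 : g ⬝ᵥ η = 0 := by
      simp only [dotProduct, hc]
      rw [← Finset.mul_sum, mem_H0_iff.1 hη, mul_zero]
    simp [h1, hc]
  push Not at hc
  obtain ⟨u, hu⟩ := hc
  obtain ⟨w', hw'T, hw'⟩ := Set.exists_max_image {v | g v < g w} g (Set.toFinite _)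
    ⟨u, lt_of_le_of_ne (hw u) hu⟩
  have hw'T : g w' < g w := hw'T
  have hw' : ∀ v, g v < g w → g v ≤ g w' := hw'
  set g' : V → ℝ := fun v => min (g v) (g w') with hg'
  obtain ⟨S, hSmem⟩ : ∃ S : Set V, ∀ v, v ∈ S ↔ g v = g w := ⟨{v | g v = g w}, fun _ => Iff.rfl⟩
  have htop : ∀ v, v ∈ S → g v = g w ∧ g' v = g w' := fun v hv =>
    ⟨(hSmem v).1 hv, by simp only [hg']; rw [(hSmem v).1 hv]; exact min_eq_right hw'T.le⟩
  have hlow : ∀ v, v ∉ S → g' v = g v ∧ g v ≤ g w' := fun v hv =>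
    ⟨min_eq_left (hw' v (lt_of_le_of_ne (hw v) (mt (hSmem v).2 hv))), hw' v (lt_of_le_of_ne (hw v) (mt (hSmem v).2 hv))⟩
  have hcard : (Finset.univ.image g').card < (Finset.univ.image g).card := by
    refine Finset.card_lt_card ⟨?_, fun h => ?_⟩
    · intro x hx
      obtain ⟨v, -, rfl⟩ := Finset.mem_image.1 hx
      by_cases hv : v ∈ S
      · rw [(htop v hv).2]
        exact Finset.mem_image_of_mem _ (Finset.mem_univ _)
      · rw [(hlow v hv).1]
        exact Finset.mem_image_of_mem _ (Finset.mem_univ _)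
    · obtain ⟨v, -, hv⟩ := Finset.mem_image.1 (h (Finset.mem_image_of_mem g (Finset.mem_univ w)))
      have : g' v ≤ g w' := min_le_right _ _
      linarith
  have h1 := ih _ hcard g' rfl
  have hdot : g ⬝ᵥ η = g' ⬝ᵥ η + (g w - g w') * ∑ v with v ∈ S, η v := by
    simp only [dotProduct, Finset.mul_sum, Finset.sum_filter, ← Finset.sum_add_distrib]
    refine Finset.sum_congr rfl fun v _ => ?_
    by_cases hv : v ∈ S
    · rw [if_pos hv, (htop v hv).1, (htop v hv).2]
      ring
    · rw [if_neg hv, (hlow v hv).1]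
      ring
  have hsum : ∑ e : OrientedEdge G, max (g e.head - g e.tail) 0 * a e =
      ∑ e : OrientedEdge G, max (g' e.head - g' e.tail) 0 * a e +
      (g w - g w') * ∑ e : OrientedEdge G with e.head ∈ S ∧ e.tail ∉ S, a e := by
    simp only [Finset.mul_sum, Finset.sum_filter, ← Finset.sum_add_distrib]
    refine Finset.sum_congr rfl fun e _ => ?_
    by_cases hh : e.head ∈ S <;> by_cases ht : e.tail ∈ S
    · rw [(htop _ hh).1, (htop _ hh).2, (htop _ ht).1, (htop _ ht).2]
      simp [ht]
    · rw [(htop _ hh).1, (htop _ hh).2, (hlow _ ht).1, if_pos ⟨hh, ht⟩,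
        max_eq_left (by linarith [(hlow _ ht).2]), max_eq_left (by linarith [(hlow _ ht).2])]
      ring
    · rw [(htop _ ht).1, (htop _ ht).2, (hlow _ hh).1, if_neg (by tauto),
        max_eq_right (by linarith [(hlow _ hh).2]), max_eq_right (by linarith [(hlow _ hh).2])]
      ring
    · rw [(hlow _ hh).1, (hlow _ ht).1, if_neg (by tauto)]
      ring
  rw [hdot, hsum]
  exact add_le_add h1 (mul_le_mul_of_nonneg_left (hS S) (by linarith))

/-- The support function of a cell. -/
theorem exists_mem_cell_dotProduct_eq [Fintype V] [Finite E] {G : Graph V E}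
    {a : OrientedEdge G → ℝ} (ha : ∀ e, 0 ≤ a e + a e.rev) (g : V → ℝ) :
    ∃ x ∈ cell G a, g ⬝ᵥ x = ∑ e : OrientedEdge G, max (g e.head - g e.tail) 0 * a e := by
  -- The maximizer takes the upper bound where `g` increases along the edge and the lower bound
  -- where it decreases; the midpoint where `g` is constant keeps it antisymmetric.
  obtain ⟨φ, hpos, hneg, hzero⟩ : ∃ φ : ℝ → ℝ → ℝ → ℝ, (∀ x p r, 0 < x → φ x p r = p) ∧
      (∀ x p r, x < 0 → φ x p r = -r) ∧ ∀ p r, φ 0 p r = (p - r) / 2 :=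
    ⟨fun x p r => if 0 < x then p else if x < 0 then -r else (p - r) / 2,
      fun x p r hx => if_pos hx, fun x p r hx => by simp [hx, hx.le.not_gt], fun p r => by simp⟩
  set α : C1 G := ⟨fun e => φ (g e.head - g e.tail) (a e) (a e.rev), by
    intro e
    simp only [OrientedEdge.rev_rev, OrientedEdge.rev_head, OrientedEdge.rev_tail]
    rcases lt_trichotomy (g e.head) (g e.tail) with h | h | h
    · rw [hpos _ _ _ (by linarith), hneg _ _ _ (by linarith), neg_neg]
    · rw [h, sub_self, hzero, hzero]
      ring
    · rw [hneg _ _ _ (by linarith), hpos _ _ _ (by linarith)]⟩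
  have hα : ∀ e, (α : OrientedEdge G → ℝ) e = φ (g e.head - g e.tail) (a e) (a e.rev) :=
    fun _ => rfl
  refine ⟨_, ⟨α, fun e => ?_, rfl⟩, ?_⟩
  · have := ha e
    rw [hα]
    rcases lt_trichotomy (g e.head) (g e.tail) with h | h | h
    · rw [hneg _ _ _ (by linarith)]
      linarith
    · rw [h, sub_self, hzero]
      linarith
    · rw [hpos _ _ _ (by linarith)]
  · have key : ∀ e : OrientedEdge G, (g e.head - g e.tail) * (α : OrientedEdge G → ℝ) e =
        max (g e.head - g e.tail) 0 * a e +
          max (g e.rev.head - g e.rev.tail) 0 * a e.rev := by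
      intro e
      rw [hα, OrientedEdge.rev_head, OrientedEdge.rev_tail]
      rcases lt_trichotomy (g e.head) (g e.tail) with h | h | h
      · rw [hneg _ _ _ (by linarith), max_eq_right (by linarith), max_eq_left (by linarith)]
        ring
      · simp [h]
      · rw [hpos _ _ _ (by linarith), max_eq_left (by linarith), max_eq_right (by linarith)]
        ring
    rw [dotProduct_dStar, Finset.sum_congr rfl fun e _ => key e, Finset.sum_add_distrib,
      OrientedEdge.sum_rev fun e : OrientedEdge G => max (g e.head - g e.tail) 0 * a e]
    ring

open Classical in
/-- A form of Hoffman's circulation theorem: the cell is cut out by the inequalities given by the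
cuts of the graph. -/
theorem mem_cell_of_cut_le [Fintype V] [Finite E] {G : Graph V E}
    {a : OrientedEdge G → ℝ} (ha : ∀ e, 0 ≤ a e + a e.rev) {η : V → ℝ} (hη : η ∈ H0 V)
    (hS : ∀ S : Set V, ∑ v with v ∈ S, η v ≤
      ∑ e : OrientedEdge G with e.head ∈ S ∧ e.tail ∉ S, a e) :
    η ∈ cell G a := by
  by_contra hmem
  have hP := isPolytope_cell ha
  -- A separating functional `g` would have a value at `η` above its maximum on the cell, but the
  -- cut inequalities bound that value by this maximum.
  obtain ⟨l, u, h1, h2⟩ :=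
    geometric_hahn_banach_closed_point hP.convex hP.isCompact.isClosed hmem
  obtain ⟨g, hg⟩ := exists_dotProduct_eq (l : (V → ℝ) →ₗ[ℝ] ℝ)
  obtain ⟨x, hx, hgx⟩ := exists_mem_cell_dotProduct_eq ha g
  have h3 := dotProduct_le_of_cut_le hη hS g
  have h4 := h1 x hx
  have h5 := hg x
  have h6 := hg η
  simp only [ContinuousLinearMap.coe_coe] at h5 h6
  linarith


/-! ### The cell of a real function on the vertices -/

/-- The upper bound on the values of the `1`-cochains in `□_f`, for a real function `f`. -/
noncomputable def bound {G : Graph V E} (ℓ : E → ℕ) (f : V → ℝ) (e : OrientedEdge G) : ℝ :=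
  ⌊(f e.head - f e.tail) / ℓ e.edge⌋ + 1 / 2

theorem bound_add_rev_nonneg {G : Graph V E} (ℓ : E → ℕ) (f : V → ℝ) (e : OrientedEdge G) :
    0 ≤ bound ℓ f e + bound ℓ f e.rev := by
  have h1 := Int.lt_floor_add_one ((f e.head - f e.tail) / ℓ e.edge)
  have h2 := Int.lt_floor_add_one ((f e.tail - f e.head) / ℓ e.edge)
  have h3 : (f e.tail - f e.head) / ℓ e.edge = -((f e.head - f e.tail) / ℓ e.edge) := by ring
  have h4 : (-1 : ℤ) ≤ ⌊(f e.head - f e.tail) / ℓ e.edge⌋ + ⌊(f e.tail - f e.head) / ℓ e.edge⌋ := by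
    have : (-2 : ℝ) < ((⌊(f e.head - f e.tail) / ℓ e.edge⌋ +
        ⌊(f e.tail - f e.head) / ℓ e.edge⌋ : ℤ) : ℝ) := by
      push_cast
      linarith
    have : (-2 : ℤ) < ⌊(f e.head - f e.tail) / ℓ e.edge⌋ +
        ⌊(f e.tail - f e.head) / ℓ e.edge⌋ := by exact_mod_cast this
    omega
  have h5 : (-1 : ℝ) ≤ (⌊(f e.head - f e.tail) / ℓ e.edge⌋ : ℝ) +
      ⌊(f e.tail - f e.head) / ℓ e.edge⌋ := by exact_mod_cast h4
  simp only [bound, OrientedEdge.rev_head, OrientedEdge.rev_tail, OrientedEdge.rev_edge]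
  linarith

/-- For `x₁ < x₂` the integer `⌊x₁⌋ + ⌊-x₂⌋` is negative, hence at most `-1`, which absorbs the two
summands `1 / 2`. -/
theorem le_of_mem_upperBox_bound {G : Graph V E} {ℓ : E → ℕ} (hℓ : ∀ e ∈ E(G), 0 < ℓ e)
    {f₁ f₂ : V → ℝ} {α₁ α₂ : C1 G} (h₁ : α₁ ∈ upperBox G (bound ℓ f₁))
    (h₂ : α₂ ∈ upperBox G (bound ℓ f₂)) {e : OrientedEdge G}
    (hlt : f₁ e.head - f₁ e.tail < f₂ e.head - f₂ e.tail) :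
    (α₁ : OrientedEdge G → ℝ) e ≤ (α₂ : OrientedEdge G → ℝ) e := by
  have hpos : (0 : ℝ) < ℓ e.edge := by exact_mod_cast hℓ _ e.isLink.edge_mem
  have b₁ := h₁ e
  have b₂ := h₂ e.rev
  rw [C1.apply_rev] at b₂
  simp only [bound, OrientedEdge.rev_head, OrientedEdge.rev_tail, OrientedEdge.rev_edge] at b₁ b₂
  have hx : (f₁ e.head - f₁ e.tail) / ℓ e.edge < (f₂ e.head - f₂ e.tail) / ℓ e.edge :=
    div_lt_div_of_pos_right hlt hpos
  have h3 : (f₂ e.tail - f₂ e.head) / ℓ e.edge = -((f₂ e.head - f₂ e.tail) / ℓ e.edge) := by ring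
  have c₁ := Int.floor_le ((f₁ e.head - f₁ e.tail) / ℓ e.edge)
  have c₂ := Int.floor_le ((f₂ e.tail - f₂ e.head) / ℓ e.edge)
  have h4 : ⌊(f₁ e.head - f₁ e.tail) / ℓ e.edge⌋ + ⌊(f₂ e.tail - f₂ e.head) / ℓ e.edge⌋ ≤ -1 := by
    have : ((⌊(f₁ e.head - f₁ e.tail) / ℓ e.edge⌋ +
        ⌊(f₂ e.tail - f₂ e.head) / ℓ e.edge⌋ : ℤ) : ℝ) < 0 := by
      push_cast
      linarith
    have : ⌊(f₁ e.head - f₁ e.tail) / ℓ e.edge⌋ +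
        ⌊(f₂ e.tail - f₂ e.head) / ℓ e.edge⌋ < 0 := by exact_mod_cast this
    omega
  have h5 : (⌊(f₁ e.head - f₁ e.tail) / ℓ e.edge⌋ : ℝ) +
      ⌊(f₂ e.tail - f₂ e.head) / ℓ e.edge⌋ ≤ -1 := by exact_mod_cast h4
  linarith

/-- Monotonicity of the boxes as a function of the vertex function. -/
theorem mul_nonneg_of_mem_upperBox_bound {G : Graph V E} {ℓ : E → ℕ} (hℓ : ∀ e ∈ E(G), 0 < ℓ e)
    {f₁ f₂ : V → ℝ} {α₁ α₂ : C1 G} (h₁ : α₁ ∈ upperBox G (bound ℓ f₁))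
    (h₂ : α₂ ∈ upperBox G (bound ℓ f₂)) (e : OrientedEdge G) :
    0 ≤ ((f₂ - f₁) e.head - (f₂ - f₁) e.tail) *
      ((α₂ - α₁ : C1 G) : OrientedEdge G → ℝ) e := by
  simp only [Pi.sub_apply, Submodule.coe_sub]
  rcases lt_trichotomy (f₁ e.head - f₁ e.tail) (f₂ e.head - f₂ e.tail) with h | h | h
  · have := le_of_mem_upperBox_bound hℓ h₁ h₂ h
    exact mul_nonneg (by linarith) (by linarith)
  · rw [show f₂ e.head - f₁ e.head - (f₂ e.tail - f₁ e.tail) = 0 by linarith, zero_mul]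
  · have := le_of_mem_upperBox_bound hℓ h₂ h₁ h
    exact mul_nonneg_of_nonpos_of_nonpos (by linarith) (by linarith)

theorem dotProduct_le_of_mem_cell_bound [Fintype V] [Finite E] {G : Graph V E} {ℓ : E → ℕ}
    (hℓ : ∀ e ∈ E(G), 0 < ℓ e) {f₁ f₂ : V → ℝ} {x₁ x₂ : V → ℝ}
    (h₁ : x₁ ∈ cell G (bound ℓ f₁)) (h₂ : x₂ ∈ cell G (bound ℓ f₂)) :
    (f₂ - f₁) ⬝ᵥ x₁ ≤ (f₂ - f₁) ⬝ᵥ x₂ := by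
  obtain ⟨α₁, h₁, rfl⟩ := h₁
  obtain ⟨α₂, h₂, rfl⟩ := h₂
  rw [← sub_nonneg, ← dotProduct_sub, ← map_sub, dotProduct_dStar]
  exact mul_nonneg (by norm_num)
    (Finset.sum_nonneg fun e _ => mul_nonneg_of_mem_upperBox_bound hℓ h₁ h₂ e)

/-- Equality case of monotonicity: every term of a nonnegative sum vanishes, so on each edge either
the slopes agree, and with them the bounds, or the cochains agree. -/
theorem mem_upperBox_bound_of_dotProduct_le [Fintype V] [Finite E] {G : Graph V E} {ℓ : E → ℕ}
    (hℓ : ∀ e ∈ E(G), 0 < ℓ e) {f₁ f₂ : V → ℝ} {α₁ α₂ : C1 G}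
    (h₁ : α₁ ∈ upperBox G (bound ℓ f₁)) (h₂ : α₂ ∈ upperBox G (bound ℓ f₂))
    (h : (f₂ - f₁) ⬝ᵥ dStar G α₂ ≤ (f₂ - f₁) ⬝ᵥ dStar G α₁) :
    α₁ ∈ upperBox G (bound ℓ f₂) := by
  rw [← sub_nonpos, ← dotProduct_sub, ← map_sub, dotProduct_dStar] at h
  have hn := mul_nonneg_of_mem_upperBox_bound hℓ h₁ h₂
  have h0 := (Finset.sum_eq_zero_iff_of_nonneg fun e _ => hn e).1
    (le_antisymm (by linarith) (Finset.sum_nonneg fun e _ => hn e))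
  intro e
  rcases mul_eq_zero.1 (h0 e (Finset.mem_univ e)) with he | he
  · have : bound ℓ f₂ e = bound ℓ f₁ e := by
      simp only [Pi.sub_apply] at he
      simp only [bound, show f₂ e.head - f₂ e.tail = f₁ e.head - f₁ e.tail by linarith]
    rw [this]
    exact h₁ e
  · simp only [Submodule.coe_sub, Pi.sub_apply] at he
    rw [← sub_eq_zero.1 he]
    exact h₂ e

/-- If two cells meet, they do so in the face of each that is cut out by the difference of the
two vertex functions. -/
theorem cell_bound_inter [Fintype V] [Finite E] {G : Graph V E} {ℓ : E → ℕ}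
    (hℓ : ∀ e ∈ E(G), 0 < ℓ e) {f₁ f₂ : V → ℝ}
    (hne : (cell G (bound ℓ f₁) ∩ cell G (bound ℓ f₂)).Nonempty) :
    cell G (bound ℓ f₁) ∩ cell G (bound ℓ f₂) =
      {x ∈ cell G (bound ℓ f₁) | ∀ y ∈ cell G (bound ℓ f₁), (f₂ - f₁) ⬝ᵥ y ≤ (f₂ - f₁) ⬝ᵥ x} := by
  ext x
  constructor
  · exact fun hx => ⟨hx.1, fun y hy => dotProduct_le_of_mem_cell_bound hℓ hy hx.2⟩
  · rintro ⟨hx, hmax⟩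
    refine ⟨hx, ?_⟩
    obtain ⟨z, hz₁, α₂, hα₂, rfl⟩ := hne
    obtain ⟨α₁, hα₁, rfl⟩ := hx
    exact ⟨α₁, mem_upperBox_bound_of_dotProduct_le hℓ hα₁ hα₂ (hmax _ hz₁), rfl⟩

theorem isFace_cell_bound_inter [Fintype V] [Finite E] {G : Graph V E} {ℓ : E → ℕ}
    (hℓ : ∀ e ∈ E(G), 0 < ℓ e) {f₁ f₂ : V → ℝ}
    (hne : (cell G (bound ℓ f₁) ∩ cell G (bound ℓ f₂)).Nonempty) :
    IsFace (cell G (bound ℓ f₁)) (cell G (bound ℓ f₁) ∩ cell G (bound ℓ f₂)) := by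
  refine ⟨hne, fun _ => ⟨LinearMap.toContinuousLinearMap (dotProductBilin ℝ ℝ (f₂ - f₁)), ?_⟩⟩
  exact cell_bound_inter hℓ hne

/-- Stands in for transitivity of exposed faces, which fails for general convex sets. -/
theorem isFace_cell_bound_of_subset [Fintype V] [Finite E] {G : Graph V E} {ℓ : E → ℕ}
    (hℓ : ∀ e ∈ E(G), 0 < ℓ e) {f₁ f₂ : V → ℝ}
    (hsub : cell G (bound ℓ f₂) ⊆ cell G (bound ℓ f₁)) :
    IsFace (cell G (bound ℓ f₁)) (cell G (bound ℓ f₂)) := by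
  have h : cell G (bound ℓ f₁) ∩ cell G (bound ℓ f₂) = cell G (bound ℓ f₂) :=
    Set.inter_eq_self_of_subset_right hsub
  have := isFace_cell_bound_inter (f₁ := f₁) (f₂ := f₂) hℓ
    (by rw [h]; exact cell_nonempty (bound_add_rev_nonneg ℓ _))
  rwa [h] at this

theorem isFace_self {X : Type*} [AddCommGroup X] [Module ℝ X] [TopologicalSpace X] {P : Set X}
    (hP : P.Nonempty) : IsFace P P :=
  ⟨hP, IsExposed.refl P⟩

open Filter Topology in
-- The floor is upper semicontinuous, so a small perturbation cannot raise it, and there are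
-- finitely many edges.
theorem exists_pos_bound_add_smul_le [Finite V] [Finite E] {G : Graph V E} (ℓ : E → ℕ)
    (f g : V → ℝ) : ∃ ε : ℝ, 0 < ε ∧ ∀ e : OrientedEdge G, bound ℓ (f + ε • g) e ≤ bound ℓ f e := by
  have h : ∀ e : OrientedEdge G, ∀ᶠ ε : ℝ in 𝓝[>] 0, bound ℓ (f + ε • g) e ≤ bound ℓ f e := by
    intro e
    have hc : Continuous fun ε : ℝ =>
        ((f + ε • g) e.head - (f + ε • g) e.tail) / (ℓ e.edge : ℝ) := by
      simp only [Pi.add_apply, Pi.smul_apply, smul_eq_mul]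
      fun_prop
    have h0 : ((f + (0 : ℝ) • g) e.head - (f + (0 : ℝ) • g) e.tail) / (ℓ e.edge : ℝ) <
        ⌊(f e.head - f e.tail) / (ℓ e.edge : ℝ)⌋ + 1 := by
      rw [zero_smul, add_zero]
      exact Int.lt_floor_add_one _
    refine ((hc.tendsto 0).eventually (gt_mem_nhds h0)).filter_mono nhdsWithin_le_nhds |>.mono ?_
    intro ε hε
    have : ⌊((f + ε • g) e.head - (f + ε • g) e.tail) / (ℓ e.edge : ℝ)⌋ ≤
        ⌊(f e.head - f e.tail) / (ℓ e.edge : ℝ)⌋ :=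
      Int.lt_add_one_iff.1 (Int.floor_lt.2 (by exact_mod_cast hε))
    simp only [bound]
    gcongr
  obtain ⟨ε, h1, h2⟩ := ((eventually_all.2 h).and self_mem_nhdsWithin).exists
  exact ⟨ε, h2, h1⟩

/-- The faces of cells are again cells. -/
theorem IsFace.exists_eq_cell_bound [Fintype V] [Finite E] {G : Graph V E} {ℓ : E → ℕ}
    (hℓ : ∀ e ∈ E(G), 0 < ℓ e) {f : V → ℝ} {F : Set (V → ℝ)}
    (hF : IsFace (cell G (bound ℓ f)) F) : ∃ f' : V → ℝ, F = cell G (bound ℓ f') := by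
  obtain ⟨l, hl⟩ := hF.2 hF.1
  obtain ⟨g, hg⟩ := exists_dotProduct_eq (l : (V → ℝ) →ₗ[ℝ] ℝ)
  simp only [ContinuousLinearMap.coe_coe] at hg
  obtain ⟨ε, hε, hle⟩ := exists_pos_bound_add_smul_le (G := G) ℓ f g
  refine ⟨f + ε • g, ?_⟩
  have h : cell G (bound ℓ f) ∩ cell G (bound ℓ (f + ε • g)) = cell G (bound ℓ (f + ε • g)) :=
    Set.inter_eq_self_of_subset_right (cell_mono hle)
  have h2 := cell_bound_inter (f₁ := f) (f₂ := f + ε • g) hℓ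
    (by rw [h]; exact cell_nonempty (bound_add_rev_nonneg ℓ _))
  rw [← h, h2, hl]
  simp only [add_sub_cancel_left, smul_dotProduct, smul_eq_mul, hg, mul_le_mul_iff_right₀ hε]


/-! ### Connected graphs and their Laplacians -/

theorem IsConnected.exists_mem_notMem {G : Graph V E} (hG : IsConnected G)
    (hV : ∀ v, v ∈ V(G)) {S : Set V} {u v : V} (hu : u ∈ S) (hv : v ∉ S) :
    ∃ e : OrientedEdge G, e.tail ∈ S ∧ e.head ∉ S := by
  by_contra! h
  refine hv ?_
  have hr := hG.2 u (hV u) v (hV v)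
  clear hv
  induction hr with
  | refl => exact hu
  | tail _ hadj ih =>
    obtain ⟨e, he⟩ := hadj
    exact h ⟨e, _, _, he⟩ ih

theorem IsConnected.eq_of_forall_edge {X : Type*} {G : Graph V E} (hG : IsConnected G)
    (hV : ∀ v, v ∈ V(G)) {g : V → X} (hg : ∀ e : OrientedEdge G, g e.head = g e.tail) (u v : V) :
    g v = g u := by
  by_contra h
  obtain ⟨e, ht, hh⟩ := hG.exists_mem_notMem hV (S := {w | g w = g u}) (u := u) (v := v) rfl h
  exact hh ((hg e).trans ht)

theorem dotProduct_eq_zero_of_forall_eq [Fintype V] {g η : V → ℝ} (hη : η ∈ H0 V)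
    (hg : ∀ u v, g v = g u) : g ⬝ᵥ η = 0 := by
  rcases isEmpty_or_nonempty V with hV | ⟨⟨w⟩⟩
  · simp [dotProduct]
  · simp only [dotProduct, hg w]
    rw [← Finset.mul_sum, mem_H0_iff.1 hη, mul_zero]

/-- A functional `g` vanishing on the range of `Δ` satisfies `g ⬝ᵥ Δ g = 0`, so it is constant and
kills `H_{0,ℝ}`. -/
theorem IsConnected.exists_laplacian_eq [Fintype V] [Finite E] {G : Graph V E}
    (hG : IsConnected G) (hV : ∀ v, v ∈ V(G)) {η : V → ℝ} (hη : η ∈ H0 V) :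
    ∃ g, laplacian G g = η := by
  by_contra h
  obtain ⟨l, hl, hker⟩ := Submodule.exists_le_ker_of_notMem
    (p := LinearMap.range (laplacian G)) (v := η) (by simpa using h)
  obtain ⟨g, hg⟩ := exists_dotProduct_eq l
  refine hl ?_
  have h0 : g ⬝ᵥ laplacian G g = 0 := by
    rw [← hg]
    exact hker ⟨g, rfl⟩
  rw [dotProduct_laplacian] at h0
  have h1 := (Finset.sum_eq_zero_iff_of_nonneg fun (e : OrientedEdge G) _ =>
    mul_self_nonneg (g e.head - g e.tail)).1 (by linarith)
  rw [hg]
  exact dotProduct_eq_zero_of_forall_eq hη (hG.eq_of_forall_edge hV fun e =>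
    sub_eq_zero.1 (mul_self_eq_zero.1 (h1 e (Finset.mem_univ e))))

/-- Expand `q (Δ g - Δ f)` with `η = Δ g`. -/
theorem mem_Vor_zero_iff [Fintype V] [Finite E] {G : Graph V E}
    (hG : IsConnected G) (hV : ∀ v, v ∈ V(G)) {η : V → ℝ} :
    η ∈ Vor G 0 ↔ η ∈ H0 V ∧ ∀ f : V → ℤ,
      2 * ((fun v => (f v : ℝ)) ⬝ᵥ η) ≤
        (fun v => (f v : ℝ)) ⬝ᵥ laplacian G fun v => (f v : ℝ) := by
  refine and_congr_right fun hη => ?_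
  obtain ⟨g, rfl⟩ := hG.exists_laplacian_eq hV hη
  rw [laplacianLattice, Set.forall_mem_range]
  refine forall_congr' fun f => ?_
  set h : V → ℝ := fun v => (f v : ℝ)
  have h1 : q G (laplacian G g - 0) = g ⬝ᵥ laplacian G g := by
    rw [sub_zero, q_laplacian]
    rfl
  have h2 : q G (laplacian G g - dStar G (d G h)) = g ⬝ᵥ laplacian G g -
      2 * (h ⬝ᵥ laplacian G g) + h ⬝ᵥ laplacian G h := by
    rw [show dStar G (d G h) = laplacian G h from rfl, ← map_sub, q_laplacian]
    change (g - h) ⬝ᵥ laplacian G (g - h) = _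
    rw [map_sub, dotProduct_sub, sub_dotProduct, sub_dotProduct, dotProduct_laplacian_comm G g h]
    ring
  rw [h1, h2]
  constructor <;> intro h3 <;> linarith

/-! ### The Voronoi cell as a cell -/

open Classical in
/-- The upper bound for `1`-cochains supported on a subgraph `G'` with all values at most `1/2` in
absolute value. -/
noncomputable def halfBound {G : Graph V E} (G' : Graph V E) (e : OrientedEdge G) : ℝ :=
  if e.edge ∈ E(G') then 1 / 2 else 0

theorem halfBound_nonneg {G : Graph V E} (G' : Graph V E) (e : OrientedEdge G) :
    0 ≤ halfBound G' e := by
  unfold halfBound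
  split_ifs <;> norm_num

theorem halfBound_add_rev_nonneg {G : Graph V E} (G' : Graph V E) (e : OrientedEdge G) :
    0 ≤ halfBound G' e + halfBound G' e.rev :=
  add_nonneg (halfBound_nonneg _ _) (halfBound_nonneg _ _)

theorem abs_le_halfBound {G : Graph V E} {G' : Graph V E} {α : C1 G}
    (hα : α ∈ upperBox G (halfBound G')) (e : OrientedEdge G) :
    |(α : OrientedEdge G → ℝ) e| ≤ halfBound G' e := by
  have h1 : -(α : OrientedEdge G → ℝ) e ≤ halfBound G' e := by
    rw [← C1.apply_rev]
    exact hα e.rev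
  exact abs_le.2 ⟨by linarith, hα e⟩

theorem mem_upperBox_halfBound_iff {G : Graph V E} {G' : Graph V E} {α : C1 G} :
    α ∈ upperBox G (halfBound G') ↔ (∀ e, |(α : OrientedEdge G → ℝ) e| ≤ 1 / 2) ∧
      ∀ e : OrientedEdge G, e.edge ∉ E(G') → (α : OrientedEdge G → ℝ) e = 0 := by
  constructor
  · refine fun hα => ⟨fun e => (abs_le_halfBound hα e).trans ?_, fun e he => ?_⟩
    · unfold halfBound
      split_ifs <;> norm_num
    · have := abs_le_halfBound hα e
      rw [halfBound, if_neg he] at this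
      exact abs_nonpos_iff.1 this
  · rintro ⟨h1, h2⟩ e
    unfold halfBound
    split_ifs with he
    · exact (le_abs_self _).trans (h1 e)
    · exact (h2 e he).le

theorem dotProduct_laplacian_of_le [Fintype V] [Finite E] {G G' : Graph V E} (hle : G' ≤ G)
    (f : V → ℝ) :
    f ⬝ᵥ laplacian G' f =
      ∑ e : OrientedEdge G, (f e.head - f e.tail) * (f e.head - f e.tail) * halfBound G' e := by
  classical
  rw [dotProduct_laplacian, Finset.mul_sum]
  simp only [halfBound, mul_ite, mul_zero]
  rw [← Finset.sum_filter]
  refine Finset.sum_bij (fun e _ => ⟨e.edge, e.tail, e.head, e.isLink.mono hle⟩) ?_ ?_ ?_ ?_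
  · intro e _
    simpa using e.isLink.edge_mem
  · rintro ⟨a, b, c, h⟩ - ⟨a', b', c', h'⟩ - hh
    simpa using hh
  · intro e he
    exact ⟨⟨e.edge, e.tail, e.head, (Graph.IsSubgraph.isLink_iff hle
      (by simpa using he)).2 e.isLink⟩, Finset.mem_univ _, rfl⟩
  · intro e _
    ring

open Classical in
theorem dotProduct_indicator_laplacian [Fintype V] [Finite E] {G G' : Graph V E} (hle : G' ≤ G)
    (S : Set V) :
    (fun v => if v ∈ S then (1 : ℝ) else 0) ⬝ᵥ laplacian G' (fun v => if v ∈ S then 1 else 0) =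
      2 * ∑ e : OrientedEdge G with e.head ∈ S ∧ e.tail ∉ S, halfBound G' e := by
  rw [dotProduct_laplacian_of_le hle, two_mul, Finset.sum_filter]
  nth_rewrite 2 [← OrientedEdge.sum_rev]
  rw [← Finset.sum_add_distrib]
  refine Finset.sum_congr rfl fun e _ => ?_
  have hr : halfBound G' e.rev = halfBound G' e := rfl
  by_cases hh : e.head ∈ S <;> by_cases ht : e.tail ∈ S <;> simp [hh, ht, hr]

/-- Indicator functions already give all the cut inequalities of the cell; the other integer
functions add nothing, because `|n| ≤ n ^ 2` on each edge. -/
theorem Vor_zero_eq_cell [Fintype V] [Finite E] {G G' : Graph V E} (hle : G' ≤ G)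
    (hG' : IsConnected G') (hV : ∀ v, v ∈ V(G')) : Vor G' 0 = cell G (halfBound G') := by
  classical
  ext η
  rw [mem_Vor_zero_iff hG' hV]
  constructor
  · rintro ⟨hη, h⟩
    refine mem_cell_of_cut_le (halfBound_add_rev_nonneg G') hη fun S => ?_
    have h1 := h fun v => if v ∈ S then 1 else 0
    push_cast at h1
    rw [dotProduct_indicator_laplacian hle S] at h1
    have h2 : (fun v => if v ∈ S then (1 : ℝ) else 0) ⬝ᵥ η = ∑ v with v ∈ S, η v := by
      simp [dotProduct, Finset.sum_filter]
    rw [h2] at h1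
    linarith
  · rintro ⟨α, hα, rfl⟩
    refine ⟨dStar_mem_H0 G α, fun f => ?_⟩
    rw [dotProduct_laplacian_of_le hle, dotProduct_dStar, ← mul_assoc,
      show (2 : ℝ) * (1 / 2) = 1 by norm_num, one_mul]
    refine Finset.sum_le_sum fun e _ => ?_
    have h1 : |(f e.head : ℝ) - f e.tail| ≤ (f e.head - f e.tail) * (f e.head - f e.tail) := by
      have : |f e.head - f e.tail| ≤ (f e.head - f e.tail) * (f e.head - f e.tail) := by
        rw [← abs_mul_abs_self, ← sq]
        exact Int.le_self_sq _
      exact_mod_cast this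
    calc _ ≤ |((f e.head : ℝ) - f e.tail) * (α : OrientedEdge G → ℝ) e| := le_abs_self _
      _ = |(f e.head : ℝ) - f e.tail| * |(α : OrientedEdge G → ℝ) e| := abs_mul _ _
      _ ≤ _ := mul_le_mul h1 (abs_le_halfBound hα e) (abs_nonneg _) (mul_self_nonneg _)

open Classical in
/-- Every vector of `H_{0,ℝ}` has a positive multiple in the Voronoi cell. -/
theorem exists_pos_smul_mem_cell_halfBound [Fintype V] [Finite E] {G G' : Graph V E}
    (hle : G' ≤ G) (hG' : IsConnected G') (hV : ∀ v, v ∈ V(G')) {η : V → ℝ} (hη : η ∈ H0 V) :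
    ∃ t : ℝ, 0 < t ∧ t • η ∈ cell G (halfBound G') := by
  set M : ℝ := ∑ v, |η v| with hM
  have hM0 : 0 ≤ M := Finset.sum_nonneg fun v _ => abs_nonneg _
  -- Every partial sum of `η` is at most `M`, while a nontrivial cut has capacity at least `1 / 2`
  -- by connectedness of `G'`.
  refine ⟨1 / (2 * (M + 1)), by positivity, mem_cell_of_cut_le (halfBound_add_rev_nonneg G')
    ((H0 V).smul_mem _ hη) fun S => ?_⟩
  simp only [Pi.smul_apply, smul_eq_mul]
  rw [← Finset.mul_sum]
  have hnn : ∀ e ∈ (Finset.univ.filter fun e : OrientedEdge G => e.head ∈ S ∧ e.tail ∉ S),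
      0 ≤ halfBound G' e := fun e _ => halfBound_nonneg _ _
  by_cases hS : ∃ u v, u ∈ S ∧ v ∉ S
  · obtain ⟨u, v, hu, hv⟩ := hS
    obtain ⟨e, ht, hh⟩ := hG'.exists_mem_notMem hV hu hv
    have h1 : (1 : ℝ) / 2 ≤
        ∑ e : OrientedEdge G with e.head ∈ S ∧ e.tail ∉ S, halfBound G' e := by
      have h := Finset.single_le_sum hnn
        (a := ⟨e.edge, e.head, e.tail, e.isLink.symm.mono hle⟩) (by simpa using ⟨ht, hh⟩)
      rwa [halfBound, if_pos e.isLink.edge_mem] at h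
    refine le_trans ?_ h1
    have h2 : ∑ v with v ∈ S, η v ≤ M :=
      (Finset.sum_le_sum fun v _ => le_abs_self (η v)).trans
        (Finset.sum_le_sum_of_subset_of_nonneg (Finset.filter_subset _ _)
          fun v _ _ => abs_nonneg _)
    rw [div_mul_eq_mul_div, div_le_div_iff₀ (by positivity) (by norm_num)]
    linarith
  · have h0 : ∑ v with v ∈ S, η v = 0 := by
      by_cases hu : ∃ u, u ∈ S
      · obtain ⟨u, hu⟩ := hu
        have : ∀ v, v ∈ S := fun v => by_contra fun hv => hS ⟨u, v, hu, hv⟩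
        simpa [this] using mem_H0_iff.1 hη
      · push Not at hu
        simp [hu]
    rw [h0, mul_zero]
    exact Finset.sum_nonneg hnn


/-! ### Integer functions on the vertices -/

theorem floor_intCast_div_natCast (a : ℤ) (n : ℕ) : ⌊(a : ℝ) / n⌋ = a / n := by
  rw [Int.floor_div_natCast, Int.floor_intCast]

theorem bound_intCast {G : Graph V E} (ℓ : E → ℕ) (f : V → ℤ) (e : OrientedEdge G) :
    bound ℓ (fun v => (f v : ℝ)) e = ((f e.head - f e.tail) / ℓ e.edge : ℤ) + 1 / 2 := by
  rw [bound, ← Int.cast_sub, floor_intCast_div_natCast]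

theorem mem_edgeSet_subgraph_iff {G : Graph V E} (ℓ : E → ℕ) (f : V → ℤ) (e : OrientedEdge G) :
    e.edge ∈ E(subgraph G ℓ f) ↔ (ℓ e.edge : ℤ) ∣ f e.head - f e.tail := by
  simp only [subgraph, Graph.edgeSet_restrict, Set.mem_inter_iff, e.isLink.edge_mem, true_and,
    Set.mem_ofPred_eq]
  constructor
  · exact fun h => h _ _ e.isLink
  · intro h u v huv
    rcases e.isLink.eq_and_eq_or_eq_and_eq huv with ⟨rfl, rfl⟩ | ⟨rfl, rfl⟩
    · exact h
    · rwa [← dvd_neg, neg_sub]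

theorem neg_sub_one_ediv {n : ℤ} (hn : 0 < n) (x : ℤ) : (-x - 1) / n = -(x / n) - 1 := by
  have h1 := Int.emod_add_mul_ediv x n
  have h2 := Int.emod_nonneg x hn.ne'
  have h3 := Int.emod_lt_of_pos x hn
  refine (Int.ediv_eq_iff_of_pos hn).2 ⟨?_, ?_⟩ <;> nlinarith

theorem neg_ediv_of_not_dvd {n : ℤ} (hn : 0 < n) {x : ℤ} (hx : ¬ n ∣ x) :
    -x / n = -(x / n) - 1 := by
  have h1 := Int.emod_add_mul_ediv x n
  have h2 := Int.emod_pos_of_not_dvd hx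
  have h3 := Int.emod_lt_of_pos x hn
  refine (Int.ediv_eq_iff_of_pos hn).2 ⟨?_, ?_⟩ <;> rcases h2 with h2 | h2 <;> nlinarith

/-- Midpoint plus half-width: the interval of values on an edge has length `1` if the length divides
the slope and `0` otherwise. -/
theorem frakD_add_halfBound {G : Graph V E} {ℓ : E → ℕ} (hℓ : ∀ e ∈ E(G), 0 < ℓ e) (f : V → ℤ)
    (e : OrientedEdge G) :
    (frakD G ℓ f : OrientedEdge G → ℝ) e + halfBound (subgraph G ℓ f) e =
      bound ℓ (fun v => (f v : ℝ)) e := by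
  have hpos : (0 : ℤ) < ℓ e.edge := by exact_mod_cast hℓ _ e.isLink.edge_mem
  have h1 : (frakD G ℓ f : OrientedEdge G → ℝ) e =
      (((f e.head - f e.tail) / ℓ e.edge : ℤ) - (-(f e.head - f e.tail) / ℓ e.edge : ℤ) : ℝ) / 2 := by
    simp only [frakD, delta, OrientedEdge.rev_head, OrientedEdge.rev_tail, OrientedEdge.rev_edge,
      ← Int.cast_sub, floor_intCast_div_natCast, neg_sub]
  rw [h1, bound_intCast, halfBound]
  simp only [mem_edgeSet_subgraph_iff]
  split_ifs with h
  · rw [Int.neg_ediv_of_dvd h]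
    push_cast
    ring
  · rw [neg_ediv_of_not_dvd hpos h]
    push_cast
    ring

theorem cube_eq_image (G : Graph V E) (ℓ : E → ℕ) (f : V → ℤ) :
    cube G ℓ f = (fun ε => frakD G ℓ f + ε) '' upperBox G (halfBound (subgraph G ℓ f)) := by
  ext x
  constructor
  · rintro ⟨ε, rfl, h⟩
    exact ⟨ε, mem_upperBox_halfBound_iff.2 h, rfl⟩
  · rintro ⟨ε, hε, rfl⟩
    exact ⟨ε, rfl, mem_upperBox_halfBound_iff.1 hε⟩

theorem VorH_eq_image [Finite V] [Finite E] (G : Graph V E) (ℓ : E → ℕ) (f : V → ℤ) :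
    VorH G ℓ f = (fun x => dStar G (frakD G ℓ f) + x) ''
      cell G (halfBound (subgraph G ℓ f)) := by
  rw [VorH, cube_eq_image, cell, Set.image_image, Set.image_image]
  simp only [map_add]

theorem VorH_eq_cell [Finite V] [Finite E] {G : Graph V E} {ℓ : E → ℕ}
    (hℓ : ∀ e ∈ E(G), 0 < ℓ e) (f : V → ℤ) :
    VorH G ℓ f = cell G (bound ℓ fun v => (f v : ℝ)) := by
  rw [VorH, cube_eq_image, cell]
  congr 1
  ext α
  constructor
  · rintro ⟨ε, hε, rfl⟩ e
    rw [← frakD_add_halfBound hℓ]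
    simpa using hε e
  · intro hα
    refine ⟨α - frakD G ℓ f, fun e => ?_, by simp⟩
    have := hα e
    rw [← frakD_add_halfBound hℓ] at this
    simp only [Submodule.coe_sub, Pi.sub_apply]
    linarith

/-! ### Enlarging the subgraph `G_f` -/

theorem subgraph_le (G : Graph V E) (ℓ : E → ℕ) (f : V → ℤ) : subgraph G ℓ f ≤ G :=
  Graph.restrict_le

/-- The quotient drops only when the multiple of `n` below `x` is passed, and `j = x % n` lands
exactly on it; landing there at `j = t` is harmless. -/
theorem ediv_le_ediv_sub_of_not_dvd {n x t : ℤ} (hn : 0 < n)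
    (h : ∀ j, 1 ≤ j → j < t → ¬ n ∣ x - j) (hx : ¬ n ∣ x) : x / n ≤ (x - t) / n := by
  have h1 := Int.emod_add_mul_ediv x n
  have h2 := Int.emod_nonneg x hn.ne'
  have h3 : x % n ≠ 0 := fun h0 => hx (Int.dvd_of_emod_eq_zero h0)
  rw [Int.le_ediv_iff_mul_le hn]
  by_contra! hlt
  refine h (x % n) (by omega) (by nlinarith) ⟨x / n, by linarith⟩

open Classical in
/-- The number of oriented edges of `G_f`. -/
noncomputable def edgeCount [Finite V] [Finite E] (G : Graph V E) (ℓ : E → ℕ) (f : V → ℤ) : ℕ :=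
  (Finset.univ.filter fun e : OrientedEdge G => (ℓ e.edge : ℤ) ∣ f e.head - f e.tail).card

open Classical in
/-- If `G_f` is not connected, adding a suitable multiple of the indicator function of one of its
components enlarges the box and `G_f`. -/
theorem exists_edgeCount_lt [Finite V] [Finite E] {G : Graph V E} {ℓ : E → ℕ}
    (hV : ∀ v, v ∈ V(G)) (hconn : IsConnected G) (hℓ : ∀ e ∈ E(G), 0 < ℓ e) {f : V → ℤ}
    (hf : ¬ IsConnected (subgraph G ℓ f)) :
    ∃ f' : V → ℤ, edgeCount G ℓ f < edgeCount G ℓ f' ∧ ∀ e : OrientedEdge G,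
      bound ℓ (fun v => (f v : ℝ)) e ≤ bound ℓ (fun v => (f' v : ℝ)) e := by
  have hpos : ∀ e : OrientedEdge G, (0 : ℤ) < ℓ e.edge := fun e => by
    exact_mod_cast hℓ _ e.isLink.edge_mem
  obtain ⟨u, v, huv⟩ : ∃ u v, ¬ Relation.ReflTransGen (subgraph G ℓ f).Adj u v := by
    by_contra! h
    exact hf ⟨hconn.1, fun u _ v _ => h u v⟩
  set S : Set V := {w | Relation.ReflTransGen (subgraph G ℓ f).Adj u w} with hS
  have hcross : ∀ e : OrientedEdge G, e.tail ∈ S → e.head ∉ S →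
      ¬ (ℓ e.edge : ℤ) ∣ f e.head - f e.tail := by
    intro e ht hh hdvd
    refine hh (Relation.ReflTransGen.tail ht ⟨e.edge, ?_⟩)
    exact (Graph.IsSubgraph.isLink_iff (subgraph_le G ℓ f)
      ((mem_edgeSet_subgraph_iff ℓ f e).2 hdvd)).2 e.isLink
  clear_value S
  -- The least such `t` is the first shift of the component `S` at which a cut edge joins `G_f`;
  -- until then no outgoing quotient drops, and incoming ones only grow.
  have hex : ∃ t : ℕ, 1 ≤ t ∧ ∃ e : OrientedEdge G, e.tail ∈ S ∧ e.head ∉ S ∧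
      (ℓ e.edge : ℤ) ∣ f e.head - f e.tail - t := by
    obtain ⟨e, ht, hh⟩ := hconn.exists_mem_notMem hV (S := S) (u := u) (v := v)
      (by rw [hS]; exact Relation.ReflTransGen.refl) (by rw [hS]; exact huv)
    have h1 := Int.emod_nonneg (f e.head - f e.tail) (hpos e).ne'
    have h2 : (f e.head - f e.tail) % ℓ e.edge ≠ 0 := fun h0 =>
      hcross e ht hh (Int.dvd_of_emod_eq_zero h0)
    refine ⟨((f e.head - f e.tail) % ℓ e.edge).toNat, by omega, e, ht, hh, ?_⟩
    rw [Int.toNat_of_nonneg h1]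
    exact Int.dvd_self_sub_emod
  obtain ⟨ht1, e₀, he₀t, he₀h, he₀⟩ := Nat.find_spec hex
  have hmin : ∀ e : OrientedEdge G, e.tail ∈ S → e.head ∉ S → ∀ j : ℤ, 1 ≤ j →
      j < (Nat.find hex : ℤ) → ¬ (ℓ e.edge : ℤ) ∣ f e.head - f e.tail - j := by
    intro e ht hh j hj1 hj2 hdvd
    lift j to ℕ using by omega
    exact Nat.find_min hex (by exact_mod_cast hj2) ⟨by exact_mod_cast hj1, e, ht, hh, hdvd⟩
  generalize Nat.find hex = t at *
  refine ⟨fun w => f w + if w ∈ S then (t : ℤ) else 0, Finset.card_lt_card ⟨?_, fun h => ?_⟩, ?_⟩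
  · intro e he
    simp only [Finset.mem_filter, Finset.mem_univ, true_and] at he ⊢
    have h1 := hcross e
    have h2 := hcross e.rev
    simp only [OrientedEdge.rev_head, OrientedEdge.rev_tail, OrientedEdge.rev_edge] at h2
    by_cases hh : e.head ∈ S <;> by_cases ht : e.tail ∈ S
    · simpa [hh, ht] using he
    · exact absurd (by rwa [← dvd_neg, neg_sub]) (h2 hh ht)
    · exact absurd he (h1 ht hh)
    · simpa [hh, ht] using he
  · have := @h e₀ (by
      simp only [Finset.mem_filter, Finset.mem_univ, true_and]
      simpa [he₀t, he₀h, sub_sub] using he₀)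
    simp only [Finset.mem_filter, Finset.mem_univ, true_and] at this
    exact hcross e₀ he₀t he₀h this
  · intro e
    rw [bound_intCast, bound_intCast]
    have key : (f e.head - f e.tail) / (ℓ e.edge : ℤ) ≤
        ((f e.head + if e.head ∈ S then (t : ℤ) else 0) -
          (f e.tail + if e.tail ∈ S then (t : ℤ) else 0)) / ℓ e.edge := by
      by_cases hh : e.head ∈ S <;> by_cases ht : e.tail ∈ S
      · simp [hh, ht]
      · rw [if_pos hh, if_neg ht]
        exact Int.ediv_le_ediv (hpos e) (by omega)
      · rw [if_pos ht, if_neg hh, add_zero, ← sub_sub]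
        exact ediv_le_ediv_sub_of_not_dvd (hpos e) (hmin e ht hh) (hcross e ht hh)
      · simp [hh, ht]
    gcongr

theorem exists_isConnected_bound_le [Finite V] [Finite E] {G : Graph V E} {ℓ : E → ℕ}
    (hV : ∀ v, v ∈ V(G)) (hconn : IsConnected G) (hℓ : ∀ e ∈ E(G), 0 < ℓ e) (f : V → ℤ) :
    ∃ f' : V → ℤ, IsConnected (subgraph G ℓ f') ∧ ∀ e : OrientedEdge G,
      bound ℓ (fun v => (f v : ℝ)) e ≤ bound ℓ (fun v => (f' v : ℝ)) e := by
  induction hn : Fintype.card (OrientedEdge G) - edgeCount G ℓ f using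
    Nat.strong_induction_on generalizing f with
  | _ n ih =>
  subst hn
  by_cases hf : IsConnected (subgraph G ℓ f)
  · exact ⟨f, hf, fun _ => le_rfl⟩
  obtain ⟨f₁, hlt, h₁⟩ := exists_edgeCount_lt hV hconn hℓ hf
  have hle : edgeCount G ℓ f₁ ≤ Fintype.card (OrientedEdge G) := Finset.card_le_univ _
  obtain ⟨f₂, h₂, h₃⟩ := ih _ (by omega) f₁ rfl
  exact ⟨f₂, h₂, fun e => (h₁ e).trans (h₃ e)⟩


/-! ### The cells cover the hyperplane -/

/-- The convex piecewise linear function on the integers whose slope between `x` and `x + 1` is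
`⌊x / n⌋ + 1 / 2`. -/
noncomputable def potential (n x : ℤ) : ℝ :=
  x * ((x / n : ℤ) + 1 / 2) - n * (x / n : ℤ) * ((x / n : ℤ) + 1) / 2

theorem potential_add_one {n : ℤ} (hn : 0 < n) (x : ℤ) :
    potential n (x + 1) - potential n x = (x / n : ℤ) + 1 / 2 := by
  have h1 := Int.emod_add_mul_ediv x n
  have h2 := Int.emod_nonneg x hn.ne'
  have h3 := Int.emod_lt_of_pos x hn
  -- The quotient jumps at `x + 1` only if `x` ends its block of length `n`; the quadratic
  -- correction makes the two linear pieces agree there.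
  rcases eq_or_ne (x % n + 1) n with h | h
  · have hx : x + 1 = n * (x / n + 1) := by linarith
    have hk : (x + 1) / n = x / n + 1 := by
      rw [hx, Int.mul_ediv_cancel_left _ hn.ne']
    have hx' : (x : ℝ) + 1 = n * ((x / n : ℤ) + 1) := by exact_mod_cast hx
    simp only [potential, hk]
    push_cast
    linear_combination hx'
  · have hk : (x + 1) / n = x / n := by
      refine (Int.ediv_eq_iff_of_pos hn).2 ⟨by nlinarith, ?_⟩
      have : x % n + 1 < n := by omega
      nlinarith
    simp only [potential, hk]
    push_cast
    ring

theorem potential_neg_sub_one {n : ℤ} (hn : 0 < n) (x : ℤ) :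
    potential n (-x - 1) - potential n (-x) = (x / n : ℤ) + 1 / 2 := by
  have h := potential_add_one hn (-x - 1)
  rw [sub_add_cancel, neg_sub_one_ediv hn] at h
  push_cast at h
  linarith

/-- With `x = r + n * k`, the difference of the two sides is `r * (n - r) / (2 * n)`. -/
theorem sq_le_potential {n : ℤ} (hn : 0 < n) (x : ℤ) : (x : ℝ) ^ 2 / (2 * n) ≤ potential n x := by
  have h1 : ((x % n : ℤ) : ℝ) + n * (x / n : ℤ) = x := by exact_mod_cast Int.emod_add_mul_ediv x n
  have h2 : (0 : ℝ) ≤ (x % n : ℤ) := by exact_mod_cast Int.emod_nonneg x hn.ne'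
  have h3 : ((x % n : ℤ) : ℝ) ≤ n := by exact_mod_cast (Int.emod_lt_of_pos x hn).le
  have hn' : (0 : ℝ) < n := by exact_mod_cast hn
  unfold potential
  generalize ((x % n : ℤ) : ℝ) = r at *
  generalize ((x / n : ℤ) : ℝ) = k at *
  rw [div_le_iff₀ (by positivity), ← h1]
  nlinarith [mul_nonneg h2 (sub_nonneg.2 h3)]

/-- Coercivity after a linear perturbation; the constant comes from completing the square in `|x|`.
-/
theorem abs_sub_le_potential {n : ℤ} (hn : 0 < n) (x : ℤ) (b : ℝ) :
    |(x : ℝ)| - n * (|b| + 1) ^ 2 / 2 ≤ potential n x - b * x := by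
  have hn' : (0 : ℝ) < n := by exact_mod_cast hn
  have h1 := sq_le_potential hn x
  have h2 : b * x ≤ |b| * |(x : ℝ)| := (le_abs_self _).trans (abs_mul _ _).le
  have h3 : (|b| + 1) * |(x : ℝ)| - n * (|b| + 1) ^ 2 / 2 ≤ (x : ℝ) ^ 2 / (2 * n) := by
    rw [le_div_iff₀ (by positivity), ← sq_abs (x : ℝ)]
    nlinarith [sq_nonneg (|(x : ℝ)| - n * (|b| + 1))]
  linarith

/-- The energy of an integer function relative to the vector `d^* (d g)`. -/
noncomputable def energy [Finite V] [Finite E] (G : Graph V E) (ℓ : E → ℕ) (g : V → ℝ)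
    (f : V → ℤ) : ℝ :=
  (1 / 2) * ∑ e : OrientedEdge G, (potential (ℓ e.edge) (f e.head - f e.tail) -
    (g e.head - g e.tail) * (f e.head - f e.tail : ℤ))

theorem energy_add_const [Finite V] [Finite E] (G : Graph V E) (ℓ : E → ℕ) (g : V → ℝ)
    (f : V → ℤ) (c : ℤ) : energy G ℓ g (fun v => f v + c) = energy G ℓ g f := by
  simp only [energy, add_sub_add_right_eq_sub]

open Classical in
-- Only cut edges change, by one unit of slope, and the unit increments of `potential` are the
-- values of `bound`. The two orientations contribute equally, which cancels the factor `1 / 2`.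
theorem energy_add_indicator [Fintype V] [Finite E] {G : Graph V E} {ℓ : E → ℕ}
    (hℓ : ∀ e ∈ E(G), 0 < ℓ e) (g : V → ℝ) (f : V → ℤ) (S : Set V) :
    energy G ℓ g (fun v => f v + if v ∈ S then 1 else 0) - energy G ℓ g f =
      ∑ e : OrientedEdge G with e.head ∈ S ∧ e.tail ∉ S, bound ℓ (fun v => (f v : ℝ)) e -
        ∑ v with v ∈ S, laplacian G g v := by
  have hpos : ∀ e : OrientedEdge G, (0 : ℤ) < ℓ e.edge := fun e => by
    exact_mod_cast hℓ _ e.isLink.edge_mem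
  set B : OrientedEdge G → ℝ := fun e =>
    if e.head ∈ S ∧ e.tail ∉ S then bound ℓ (fun v => (f v : ℝ)) e else 0 with hB
  have h1 : ∑ v with v ∈ S, laplacian G g v =
      (fun v => if v ∈ S then (1 : ℝ) else 0) ⬝ᵥ laplacian G g := by
    simp [dotProduct, Finset.sum_filter]
  have h2 : ∑ e : OrientedEdge G with e.head ∈ S ∧ e.tail ∉ S, bound ℓ (fun v => (f v : ℝ)) e =
      (1 / 2) * ∑ e : OrientedEdge G, (B e + B e.rev) := by
    rw [Finset.sum_add_distrib, OrientedEdge.sum_rev B, Finset.sum_filter]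
    ring
  rw [h1, h2, dotProduct_laplacian, energy, energy, ← mul_sub, ← mul_sub,
    ← Finset.sum_sub_distrib, ← Finset.sum_sub_distrib]
  congr 1
  refine Finset.sum_congr rfl fun e _ => ?_
  by_cases hh : e.head ∈ S <;> by_cases ht : e.tail ∈ S
  · simp [hB, hh, ht]
  · have h3 := potential_add_one (hpos e) (f e.head - f e.tail)
    simp only [hB, hh, ht, OrientedEdge.rev_head, OrientedEdge.rev_tail, if_true, if_false,
      and_self, not_true_eq_false, not_false_eq_true, bound_intCast, add_zero]
    rw [← h3, show f e.head + 1 - f e.tail = f e.head - f e.tail + 1 by ring]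
    push_cast
    ring
  · have h3 := potential_neg_sub_one (hpos e) (f e.tail - f e.head)
    simp only [hB, hh, ht, OrientedEdge.rev_head, OrientedEdge.rev_tail, OrientedEdge.rev_edge,
      if_true, if_false, and_self, not_true_eq_false, not_false_eq_true,
      bound_intCast, add_zero]
    rw [← h3, show f e.head - (f e.tail + 1) = -(f e.tail - f e.head) - 1 by ring,
      show f e.head - f e.tail = -(f e.tail - f e.head) by ring]
    push_cast
    ring
  · simp [hB, hh, ht]

theorem exists_abs_sub_le_of_energy_le [Finite V] [Finite E] {G : Graph V E} {ℓ : E → ℕ}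
    (hℓ : ∀ e ∈ E(G), 0 < ℓ e) (g : V → ℝ) (c : ℝ) :
    ∃ R : ℤ, ∀ f : V → ℤ, energy G ℓ g f ≤ c → ∀ e : OrientedEdge G,
      |f e.head - f e.tail| ≤ R := by
  set C : OrientedEdge G → ℝ := fun e => (ℓ e.edge : ℤ) * (|g e.head - g e.tail| + 1) ^ 2 / 2
  refine ⟨⌈2 * c + ∑ e, C e⌉, fun f hf e => ?_⟩
  have h1 : ∑ e : OrientedEdge G, (|((f e.head - f e.tail : ℤ) : ℝ)| - C e) ≤ 2 * c := by
    refine le_trans (Finset.sum_le_sum fun e _ => abs_sub_le_potential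
      (by exact_mod_cast hℓ _ e.isLink.edge_mem) (f e.head - f e.tail) (g e.head - g e.tail)) ?_
    unfold energy at hf
    linarith
  rw [Finset.sum_sub_distrib] at h1
  have h2 := Finset.single_le_sum
    (f := fun e : OrientedEdge G => |((f e.head - f e.tail : ℤ) : ℝ)|)
    (fun e _ => abs_nonneg _) (Finset.mem_univ e)
  have h3 : ((|f e.head - f e.tail| : ℤ) : ℝ) ≤ 2 * c + ∑ e, C e := by
    push_cast at *
    linarith
  exact_mod_cast h3.trans (Int.le_ceil _)

theorem IsConnected.finite_setOf_abs_sub_le [Finite V] {G : Graph V E} (hG : IsConnected G)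
    (hV : ∀ v, v ∈ V(G)) (w : V) (R : ℤ) :
    {f : V → ℤ | f w = 0 ∧ ∀ e : OrientedEdge G, |f e.head - f e.tail| ≤ R}.Finite := by
  have h : ∀ v, ∃ N : ℤ, ∀ f : V → ℤ, f w = 0 →
      (∀ e : OrientedEdge G, |f e.head - f e.tail| ≤ R) → |f v| ≤ N := by
    intro v
    induction hG.2 w (hV w) v (hV v) with
    | refl => exact ⟨0, fun f h _ => by simp [h]⟩
    | @tail b c _ hadj ih =>
      obtain ⟨N, hN⟩ := ih
      obtain ⟨e, he⟩ := hadj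
      refine ⟨N + R, fun f h0 hf => ?_⟩
      have h1 := hN f h0 hf
      have h2 := hf ⟨e, b, c, he⟩
      simp only [abs_le] at h1 h2 ⊢
      omega
  choose N hN using h
  have := Fintype.ofFinite V
  classical
  refine (Set.finite_Icc (fun v => -N v) N).subset ?_
  rintro f ⟨h0, hf⟩
  exact ⟨fun v => (abs_le.1 (hN v f h0 hf)).1, fun v => (abs_le.1 (hN v f h0 hf)).2⟩

/-- The energy ignores constants, so `f w = 0` may be assumed; coercivity and connectedness then
leave finitely many candidates. -/
theorem exists_energy_le [Finite V] [Finite E] {G : Graph V E} {ℓ : E → ℕ}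
    (hV : ∀ v, v ∈ V(G)) (hconn : IsConnected G) (hℓ : ∀ e ∈ E(G), 0 < ℓ e) (g : V → ℝ) :
    ∃ f : V → ℤ, ∀ f' : V → ℤ, energy G ℓ g f ≤ energy G ℓ g f' := by
  obtain ⟨w, -⟩ := hconn.1
  obtain ⟨R, hR⟩ := exists_abs_sub_le_of_energy_le hℓ g (energy G ℓ g 0)
  have hfin : {f : V → ℤ | f w = 0 ∧ energy G ℓ g f ≤ energy G ℓ g 0}.Finite :=
    (hconn.finite_setOf_abs_sub_le hV w R).subset fun f hf => ⟨hf.1, hR f hf.2⟩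
  obtain ⟨f, hf, hmin⟩ := Set.exists_min_image _ (energy G ℓ g) hfin ⟨0, rfl, le_rfl⟩
  refine ⟨f, fun f' => ?_⟩
  rcases le_total (energy G ℓ g f') (energy G ℓ g 0) with h | h
  · rw [← energy_add_const G ℓ g f' (-f' w)] at h ⊢
    exact hmin _ ⟨add_neg_cancel _, h⟩
  · exact hf.2.trans h

theorem exists_mem_cell_bound [Fintype V] [Finite E] {G : Graph V E} {ℓ : E → ℕ}
    (hV : ∀ v, v ∈ V(G)) (hconn : IsConnected G) (hℓ : ∀ e ∈ E(G), 0 < ℓ e) {η : V → ℝ}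
    (hη : η ∈ H0 V) : ∃ f : V → ℤ, η ∈ cell G (bound ℓ fun v => (f v : ℝ)) := by
  classical
  obtain ⟨g, rfl⟩ := hconn.exists_laplacian_eq hV hη
  obtain ⟨f, hf⟩ := exists_energy_le hV hconn hℓ g
  refine ⟨f, mem_cell_of_cut_le (bound_add_rev_nonneg ℓ _) hη fun S => ?_⟩
  have h1 := hf fun v => f v + if v ∈ S then 1 else 0
  have h2 := energy_add_indicator hℓ g f S
  linarith

theorem exists_mem_VorH [Fintype V] [Finite E] {G : Graph V E} {ℓ : E → ℕ}
    (hV : ∀ v, v ∈ V(G)) (hconn : IsConnected G) (hℓ : ∀ e ∈ E(G), 0 < ℓ e) {η : V → ℝ}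
    (hη : η ∈ H0 V) : ∃ f : V → ℤ, IsConnected (subgraph G ℓ f) ∧ η ∈ VorH G ℓ f := by
  obtain ⟨f, hf⟩ := exists_mem_cell_bound hV hconn hℓ hη
  obtain ⟨f', hf', hle⟩ := exists_isConnected_bound_le hV hconn hℓ f
  refine ⟨f', hf', ?_⟩
  rw [VorH_eq_cell hℓ]
  exact cell_mono hle hf

/-! ### The tiling -/

theorem VorH_nonempty [Finite V] [Finite E] {G : Graph V E} {ℓ : E → ℕ}
    (hℓ : ∀ e ∈ E(G), 0 < ℓ e) (f : V → ℤ) : (VorH G ℓ f).Nonempty := by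
  rw [VorH_eq_cell hℓ]
  exact cell_nonempty (bound_add_rev_nonneg ℓ _)

theorem VorH_subset_H0 [Fintype V] [Finite E] (G : Graph V E) (ℓ : E → ℕ) (f : V → ℤ) :
    VorH G ℓ f ⊆ H0 V := by
  rintro _ ⟨α, -, rfl⟩
  exact dStar_mem_H0 G α

theorem exists_eq_cell_of_mem_mixedVoronoiTiling [Fintype V] [Finite E] {G : Graph V E}
    {ℓ : E → ℕ} (hℓ : ∀ e ∈ E(G), 0 < ℓ e) {P : Set (V → ℝ)}
    (hP : P ∈ mixedVoronoiTiling G ℓ) : ∃ f : V → ℝ, P = cell G (bound ℓ f) := by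
  obtain ⟨f, -, hface⟩ := hP
  rw [VorH_eq_cell hℓ] at hface
  exact hface.exists_eq_cell_bound hℓ

theorem isTiling_mixedVoronoiTiling [Fintype V] [Finite E] {G : Graph V E} {ℓ : E → ℕ}
    (hV : ∀ v, v ∈ V(G)) (hconn : IsConnected G) (hℓ : ∀ e ∈ E(G), 0 < ℓ e) :
    IsTiling (H0 V) (mixedVoronoiTiling G ℓ) where
  isPolytope P hP := by
    obtain ⟨f, rfl⟩ := exists_eq_cell_of_mem_mixedVoronoiTiling hℓ hP
    exact isPolytope_cell (bound_add_rev_nonneg ℓ f)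
  sUnion_eq := by
    refine Set.Subset.antisymm (Set.sUnion_subset ?_) fun η hη => ?_
    · rintro P ⟨f, -, hP⟩
      exact (hP.2.subset).trans (VorH_subset_H0 G ℓ f)
    · obtain ⟨f, hf, hmem⟩ := exists_mem_VorH hV hconn hℓ hη
      exact ⟨_, ⟨f, hf, isFace_self (VorH_nonempty hℓ f)⟩, hmem⟩
  face_mem P hP F hF := by
    obtain ⟨f, rfl⟩ := exists_eq_cell_of_mem_mixedVoronoiTiling hℓ hP
    obtain ⟨f₀, hf₀, hface⟩ := hP
    -- A face of a face is a cell contained in `VorH G ℓ f₀`, hence a face of it.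
    have hsub := hF.2.subset.trans hface.2.subset
    obtain ⟨f', rfl⟩ := hF.exists_eq_cell_bound hℓ
    refine ⟨f₀, hf₀, ?_⟩
    rw [VorH_eq_cell hℓ] at hsub ⊢
    exact isFace_cell_bound_of_subset hℓ hsub
  inter P hP Q hQ := by
    obtain ⟨f₁, rfl⟩ := exists_eq_cell_of_mem_mixedVoronoiTiling hℓ hP
    obtain ⟨f₂, rfl⟩ := exists_eq_cell_of_mem_mixedVoronoiTiling hℓ hQ
    rcases Set.eq_empty_or_nonempty (cell G (bound ℓ f₁) ∩ cell G (bound ℓ f₂)) with h | h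
    · exact Or.inl h
    · refine Or.inr ⟨isFace_cell_bound_inter hℓ h, ?_⟩
      rw [Set.inter_comm] at h ⊢
      exact isFace_cell_bound_inter hℓ h

theorem vectorSpan_le_H0 [Fintype V] {P : Set (V → ℝ)} (hP : P ⊆ H0 V) :
    vectorSpan ℝ P ≤ H0 V := by
  refine Submodule.span_le.2 ?_
  rintro _ ⟨x, hx, y, hy, rfl⟩
  exact (H0 V).sub_mem (hP hx) (hP hy)

theorem VorH_eq_image_Vor [Fintype V] [Finite E] {G : Graph V E} {ℓ : E → ℕ}
    (hV : ∀ v, v ∈ V(G)) {f : V → ℤ} (hf : IsConnected (subgraph G ℓ f)) :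
    VorH G ℓ f = (fun x => dStar G (frakD G ℓ f) + x) '' Vor (subgraph G ℓ f) 0 := by
  rw [VorH_eq_image, Vor_zero_eq_cell (subgraph_le G ℓ f) hf hV]

theorem dim_VorH [Fintype V] [Finite E] {G : Graph V E} {ℓ : E → ℕ}
    (hV : ∀ v, v ∈ V(G)) {f : V → ℤ} (hf : IsConnected (subgraph G ℓ f)) :
    dim (VorH G ℓ f) = Module.finrank ℝ (H0 V) := by
  suffices h : vectorSpan ℝ (VorH G ℓ f) = H0 V by rw [dim, h]
  refine le_antisymm (vectorSpan_le_H0 (VorH_subset_H0 G ℓ f)) fun η hη => ?_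
  obtain ⟨t, ht, hmem⟩ := exists_pos_smul_mem_cell_halfBound (subgraph_le G ℓ f) hf hV hη
  have h0 : (0 : V → ℝ) ∈ cell G (halfBound (subgraph G ℓ f)) :=
    ⟨0, fun e => halfBound_nonneg _ e, map_zero _⟩
  have h1 := vsub_mem_vectorSpan ℝ
    (VorH_eq_image G ℓ f ▸ Set.mem_image_of_mem _ hmem : _ ∈ VorH G ℓ f)
    (VorH_eq_image G ℓ f ▸ Set.mem_image_of_mem _ h0 : _ ∈ VorH G ℓ f)
  rw [vsub_eq_sub, add_zero, add_sub_cancel_left] at h1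
  exact (Submodule.smul_mem_iff _ ht.ne').1 h1

/-- The exposing functional is constant on `F`; if the differences of points of `F` span `H_{0,ℝ}`,
it is constant on `P`, so it exposes all of `P`. -/
theorem IsFace.eq_of_dim_eq [Fintype V] {P F : Set (V → ℝ)} (hP : P ⊆ H0 V) (hF : IsFace P F)
    (hdim : dim F = Module.finrank ℝ (H0 V)) : F = P := by
  have hspan : vectorSpan ℝ F = H0 V :=
    Submodule.eq_of_le_of_finrank_eq (vectorSpan_le_H0 (hF.2.subset.trans hP)) hdim
  obtain ⟨l, hl⟩ := hF.2 hF.1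
  have hker : vectorSpan ℝ F ≤ LinearMap.ker (l : (V → ℝ) →ₗ[ℝ] ℝ) := by
    refine Submodule.span_le.2 ?_
    rintro _ ⟨x, hx, y, hy, rfl⟩
    rw [hl] at hx hy
    simp [le_antisymm (hy.2 x hx.1) (hx.2 y hy.1)]
  rw [hspan] at hker
  have hconst : ∀ x ∈ P, ∀ y ∈ P, l x = l y := fun x hx y hy => by
    have : l (x - y) = 0 := hker ((H0 V).sub_mem (hP hx) (hP hy))
    rwa [map_sub, sub_eq_zero] at this
  rw [hl]
  exact Set.Subset.antisymm (Set.sep_subset _ _) fun x hx =>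
    ⟨hx, fun y hy => (hconst y hy x hx).le⟩

end MixedVoronoi

theorem mainTheorem3 {V E : Type*} [Fintype V] [Finite E] (G : Graph V E)
    (hV : ∀ v, v ∈ V(G)) (hloop : ∀ e v, ¬ G.IsLoopAt e v)
    (hconn : MixedVoronoi.IsConnected G)
    (ℓ : E → ℕ) (hℓ : ∀ e ∈ E(G), 0 < ℓ e) :
    MixedVoronoi.IsTiling (MixedVoronoi.H0 V) (MixedVoronoi.mixedVoronoiTiling G ℓ) ∧
    {P | P ∈ MixedVoronoi.mixedVoronoiTiling G ℓ ∧
        MixedVoronoi.dim P = Module.finrank ℝ (MixedVoronoi.H0 V)} =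
      {P | ∃ f : V → ℤ, MixedVoronoi.IsConnected (MixedVoronoi.subgraph G ℓ f) ∧
        P = MixedVoronoi.VorH G ℓ f} ∧
    (∀ P ∈ MixedVoronoi.mixedVoronoiTiling G ℓ,
      MixedVoronoi.dim P = Module.finrank ℝ (MixedVoronoi.H0 V) →
      ∃ G' : Graph V E, G' ≤ G ∧ V(G') = V(G) ∧ MixedVoronoi.IsConnected G' ∧
        ∃ c : V → ℝ, P = (fun x => c + x) '' MixedVoronoi.Vor G' 0) ∧
    ∀ f : V → ℤ, MixedVoronoi.IsConnected (MixedVoronoi.subgraph G ℓ f) →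
      MixedVoronoi.VorH G ℓ f =
        (fun x => MixedVoronoi.dStar G (MixedVoronoi.frakD G ℓ f) + x) ''
          MixedVoronoi.Vor (MixedVoronoi.subgraph G ℓ f) 0 := by
  have hfull : ∀ P ∈ MixedVoronoi.mixedVoronoiTiling G ℓ,
      MixedVoronoi.dim P = Module.finrank ℝ (MixedVoronoi.H0 V) →
      ∃ f : V → ℤ, MixedVoronoi.IsConnected (MixedVoronoi.subgraph G ℓ f) ∧
        P = MixedVoronoi.VorH G ℓ f := by
    rintro P ⟨f, hf, hface⟩ hdim
    exact ⟨f, hf, hface.eq_of_dim_eq (MixedVoronoi.VorH_subset_H0 G ℓ f) hdim⟩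
  refine ⟨MixedVoronoi.isTiling_mixedVoronoiTiling hV hconn hℓ, ?_, ?_,
    fun f hf => MixedVoronoi.VorH_eq_image_Vor hV hf⟩
  · ext P
    refine ⟨fun hP => hfull P hP.1 hP.2, ?_⟩
    rintro ⟨f, hf, rfl⟩
    exact ⟨⟨f, hf, MixedVoronoi.isFace_self (MixedVoronoi.VorH_nonempty hℓ f)⟩,
      MixedVoronoi.dim_VorH hV hf⟩
  · intro P hP hdim
    obtain ⟨f, hf, rfl⟩ := hfull P hP hdim
    exact ⟨MixedVoronoi.subgraph G ℓ f, MixedVoronoi.subgraph_le G ℓ f, rfl, hf, _,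
      MixedVoronoi.VorH_eq_image_Vor hV hf⟩
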